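/- A composition is a finite sequence $\mathbf k=(k_1,\dots,k_r)$, $r\ge 1$, of positive integers; put $|\mathbf k|=k_1+\cdots+k_r$, $\overleftarrow{\mathbf k}=(k_r,\dots,k_1)$ and $\mathbf k_+=(k_1+1,k_2,\dots,k_r)$. The Hoffman dual $\mathbf k^\vee=(k_1',\dots,k_{r'}')$ is the unique composition with $|\mathbf k^\vee|=|\mathbf k|$ such that $\{1,\dots,|\mathbf k|-1\}$ is the disjoint union of the two sets of proper partial sums $\{\sum_{i\le j}k_i : 1\le j<r\}$ and $\{\sum_{i\le j}k'_i : 1\le j<r'\}$. For real $z<1$ let $$\mathrm{Li}_{\mathbf k}(z)=\int_0^z \frac{dt}{1-t}\Big(\frac{dt}{t}\Big)^{k_r-1}\cdots\frac{dt}{1-t}\Big(\frac{dt}{t}\Big)^{k_1-1}$$ (iterated integral, the forms belonging to $k_1$ being outermost). For $a\in\mathbb C\setminus\{0,-1,-2,\dots\}$ and a composition $\mathbf m=(m_1,\dots,m_s)$ with $m_1\ge 2$ let $$\zeta^\star(\mathbf m;a)=\sum_{n_1\ge\cdots\ge n_s>0}\frac1{(n_1+a-1)^{m_1}\cdots(n_s+a-1)^{m_s}}.$$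 **Theorem.** Let $\mathbf k=(k_1,\dots,k_r)$ be a composition. Let $\mathbb N=\{1,2,3,\dots\}$. (0) $\mathrm{Li}_{\mathbf k}$ is real-analytic on $(-\infty,1)$, and $\mathrm{Li}_{\mathbf k}(z)=\sum_{n_1>\cdots>n_r>0} z^{n_1}/(n_1^{k_1}\cdots n_r^{k_r})$ (absolutely convergent) for $|z|<1$. For every $\alpha\in\mathbb C\setminus\mathbb N$ the series $\zeta^\star\big((\overleftarrow{\mathbf k}^\vee)_+;1-\alpha\big)$ converges absolutely. (1) If $\operatorname{Re}\alpha<1$, the following integral converges absolutely and $$\int_0^1\frac{\mathrm{Li}_{\mathbf k}\big(\frac{x}{x-1}\big)}{x(1-x)^\alpha}\,dx=(-1)^r\,\zeta^\star\big((\overleftarrow{\mathbf k}^\vee)_+;1-\alpha\big).$$ (2) The left-hand side, as a function of $\alpha$ with $\operatorname{Re}\alpha<1$, has a holomorphic continuation to $\mathbb C\setminus\mathbb N$, and with the integral understood as this (unique) continuation the formula holds for every $\alpha\in\mathbb C\setminus\mathbb N$. -/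

import Mathlib

open MeasureTheory Set

namespace HurwitzStar

/-! Compositions `(k₁, …, k_r)` are lists of positive natural numbers, `k₁` being the head. -/

/-- `(k₁, k₂, …, k_r) ↦ (k₁ + 1, k₂, …, k_r)`. -/
def plusHead : List ℕ → List ℕ
  | [] => []
  | a :: t => (a + 1) :: t

/-- The Hoffman dual
`(1,…,1 [k₁ ones] + 1,…,1 [k₂ ones] + 1, … , 1 + 1,…,1 [k_r ones])`,
obtained from `((1+⋯+1), …, (1+⋯+1))` by swapping the commas and the plus signs.
Its characterization by complementary sets of partial sums is `hoffmanDual_spec`. -/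
def hoffmanDual : List ℕ → List ℕ
  | [] => []
  | [a] => List.replicate a 1
  | a :: b :: t => List.replicate (a - 1) 1 ++ plusHead (hoffmanDual (b :: t))

/-- The proper partial sums `k₁ + ⋯ + k_j`, `1 ≤ j ≤ r - 1`. -/
def partialSums (k : List ℕ) : Set ℕ :=
  {s | ∃ j, 0 < j ∧ j < k.length ∧ s = (k.take j).sum}

/-- The iterated integral
`Li_k(z) = ∫₀^z (dt/(1-t)) (dt/t)^{k_r-1} ⋯ (dt/(1-t)) (dt/t)^{k₁-1}`
for real `z < 1`; the forms belonging to `k₁` are the outermost ones. -/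
noncomputable def multiPolylog : List ℕ → ℝ → ℝ
  | [] => fun _ => 1
  | a :: t =>
      (fun (f : ℝ → ℝ) (z : ℝ) => ∫ u in (0 : ℝ)..z, f u / u)^[a - 1]
        (fun z => ∫ u in (0 : ℝ)..z, multiPolylog t u / (1 - u))

/-- Tuples `n₁ > n₂ > ⋯ > n_r > 0`. -/
abbrev StrictTuples (r : ℕ) : Type := {n : Fin r → ℕ // StrictAnti n ∧ ∀ i, 0 < n i}

/-- Tuples `n₁ ≥ n₂ ≥ ⋯ ≥ n_r > 0`. -/
abbrev WeakTuples (r : ℕ) : Type := {n : Fin r → ℕ // Antitone n ∧ ∀ i, 0 < n i}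

/-- `z^{n₁} / (n₁^{k₁} ⋯ n_r^{k_r})`. -/
noncomputable def polylogTerm (k : List ℕ) (hk : 0 < k.length) (z : ℝ)
    (n : StrictTuples k.length) : ℝ :=
  z ^ (n.1 ⟨0, hk⟩) / ∏ i, (n.1 i : ℝ) ^ k.get i

/-- `1 / ((n₁ + a - 1)^{k₁} ⋯ (n_r + a - 1)^{k_r})`. -/
noncomputable def zetaStarTerm (k : List ℕ) (a : ℂ) (n : WeakTuples k.length) : ℂ :=
  1 / ∏ i, ((n.1 i : ℂ) + a - 1) ^ k.get i

/-- The Hurwitz-type multiple zeta star value `ζ⋆(k; a)`. -/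
noncomputable def zetaStar (k : List ℕ) (a : ℂ) : ℂ :=
  ∑' n : WeakTuples k.length, zetaStarTerm k a n

/-- `Li_k(x/(x-1)) / (x (1-x)^α)`. -/
noncomputable def integrand (k : List ℕ) (α : ℂ) (x : ℝ) : ℂ :=
  (multiPolylog k (x / (x - 1)) : ℂ) / ((x : ℂ) * ((1 - x : ℝ) : ℂ) ^ α)

/-- `ℂ ∖ {1, 2, 3, …}`. -/
def punctured : Set ℂ := {α | ∀ n : ℕ, 0 < n → α ≠ (n : ℂ)}

/-- `I` is the holomorphic continuation to `ℂ ∖ {1, 2, 3, …}` of the function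
`α ↦ ∫₀¹ Li_k(x/(x-1)) / (x (1-x)^α) dx`, `Re α < 1` (the half-plane of convergence). -/
def IsContinuedIntegral (k : List ℕ) (I : ℂ → ℂ) : Prop :=
  DifferentiableOn ℂ I punctured ∧
    ∀ α : ℂ, α.re < 1 → I α = ∫ x in Ioo (0 : ℝ) 1, integrand k α x

theorem hoffmanDual_ne_nil : ∀ (k : List ℕ), k ≠ [] → (∀ a ∈ k, 0 < a) → hoffmanDual k ≠ []
  | [], h, _ => absurd rfl h
  | [a], _, hp => by
      have : 0 < a := hp a (by simp)
      simp [hoffmanDual]; omega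
  | a :: b :: t, _, hp => by
      have ih := hoffmanDual_ne_nil (b :: t) (by simp) (fun x hx => hp x (by simp_all))
      obtain ⟨c, s, hs⟩ := List.exists_cons_of_ne_nil ih
      simp [hoffmanDual, hs, plusHead]

theorem partialSums_cons (a : ℕ) (t : List ℕ) (ht : t ≠ []) (s : ℕ) :
    s ∈ partialSums (a :: t) ↔ s = a ∨ ∃ u ∈ partialSums t, s = a + u := by
  have hl : 0 < t.length := List.length_pos_iff.mpr ht
  constructor
  · rintro ⟨j, h0, hj, rfl⟩
    obtain ⟨i, rfl⟩ : ∃ i, j = i + 1 := ⟨j - 1, by omega⟩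
    rcases Nat.eq_zero_or_pos i with rfl | hi
    · left; simp
    · right
      exact ⟨_, ⟨i, hi, by simpa using hj, rfl⟩, by simp⟩
  · rintro (rfl | ⟨u, ⟨j, h0, hj, rfl⟩, rfl⟩)
    · exact ⟨1, by omega, by simpa using hl, by simp⟩
    · exact ⟨j + 1, by omega, by simpa using hj, by simp⟩

theorem partialSums_single (a s : ℕ) : ¬ s ∈ partialSums [a] := by
  rintro ⟨j, h0, hj, -⟩
  simp at hj; omega

theorem partialSums_plusHead (t : List ℕ) (ht : t ≠ []) (s : ℕ) :
    s ∈ partialSums (plusHead t) ↔ ∃ u ∈ partialSums t, s = u + 1 := by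
  obtain ⟨a, t, rfl⟩ := List.exists_cons_of_ne_nil ht
  rcases eq_or_ne t [] with rfl | h
  · simp [plusHead, partialSums_single]
  · simp only [plusHead, partialSums_cons _ _ h]
    constructor
    · rintro (rfl | ⟨u, hu, rfl⟩)
      · exact ⟨a, Or.inl rfl, rfl⟩
      · exact ⟨a + u, Or.inr ⟨u, hu, rfl⟩, by omega⟩
    · rintro ⟨v, (rfl | ⟨u, hu, rfl⟩), rfl⟩
      · exact Or.inl rfl
      · exact Or.inr ⟨u, hu, by omega⟩

theorem partialSums_replicate_append (m : ℕ) (t : List ℕ) (ht : t ≠ []) (s : ℕ) :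
    s ∈ partialSums (List.replicate m 1 ++ t) ↔
      (0 < s ∧ s ≤ m) ∨ ∃ u ∈ partialSums t, s = m + u := by
  induction m generalizing s with
  | zero => simp; omega
  | succ m ih =>
    rw [List.replicate_succ, List.cons_append, partialSums_cons _ _ (by simp [ht])]
    constructor
    · rintro (rfl | ⟨u, hu, rfl⟩)
      · left; omega
      · rcases (ih u).1 hu with h | ⟨v, hv, rfl⟩
        · left; omega
        · exact Or.inr ⟨v, hv, by omega⟩
    · rintro (h | ⟨u, hu, rfl⟩)
      · rcases Nat.lt_or_ge 1 s with h1 | h1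
        · exact Or.inr ⟨s - 1, (ih _).2 (Or.inl (by omega)), by omega⟩
        · left; omega
      · exact Or.inr ⟨m + u, (ih _).2 (Or.inr ⟨u, hu, rfl⟩), by omega⟩

theorem sum_plusHead (t : List ℕ) (ht : t ≠ []) : (plusHead t).sum = t.sum + 1 := by
  obtain ⟨a, t, rfl⟩ := List.exists_cons_of_ne_nil ht
  simp [plusHead]; omega

theorem plusHead_pos (t : List ℕ) (h : ∀ a ∈ t, 0 < a) : ∀ a ∈ plusHead t, 0 < a := by
  cases t with
  | nil => simp [plusHead]
  | cons b t =>
    intro a ha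
    simp only [plusHead, List.mem_cons] at ha
    rcases ha with rfl | ha
    · omega
    · exact h a (by simp [ha])

/-- The dual is a composition of the same weight, and the proper partial sums of the two
compositions form a partition of `{1, …, |k| - 1}`. -/
theorem hoffmanDual_spec : ∀ (k : List ℕ), k ≠ [] → (∀ a ∈ k, 0 < a) →
    (∀ a ∈ hoffmanDual k, 0 < a) ∧ (hoffmanDual k).sum = k.sum ∧
      (∀ s, (s ∈ partialSums k ∨ s ∈ partialSums (hoffmanDual k)) ↔ 0 < s ∧ s < k.sum) ∧
      ∀ s, ¬ (s ∈ partialSums k ∧ s ∈ partialSums (hoffmanDual k))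
  | [], h, _ => absurd rfl h
  | [a], _, hp => by
      have ha : 0 < a := hp a (by simp)
      have e : List.replicate a 1 = List.replicate (a - 1) 1 ++ [1] := by
        rw [← List.replicate_succ']; congr 1; omega
      refine ⟨?_, by simp [hoffmanDual], fun s => ?_, fun s h => partialSums_single _ _ h.1⟩
      · intro b hb
        simp only [hoffmanDual, List.mem_replicate] at hb
        omega
      · have h1 := partialSums_single a s
        have h2 := fun u => partialSums_single 1 u
        simp only [hoffmanDual, e, partialSums_replicate_append _ _ (List.cons_ne_nil 1 [])]
        simp only [h1, h2, false_and, exists_false, or_false, false_or, List.sum_singleton]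
        omega
  | a :: b :: t, _, hp => by
      have ha : 0 < a := hp a (by simp)
      have hp' : ∀ x ∈ b :: t, 0 < x := fun x hx => hp x (List.mem_cons_of_mem _ hx)
      have hne := hoffmanDual_ne_nil (b :: t) (by simp) hp'
      obtain ⟨i1, i2, i3, i4⟩ := hoffmanDual_spec (b :: t) (by simp) hp'
      have hne' : plusHead (hoffmanDual (b :: t)) ≠ [] := by
        obtain ⟨c, s, hs⟩ := List.exists_cons_of_ne_nil hne
        simp [hs, plusHead]
      have key : ∀ s, s ∈ partialSums (hoffmanDual (a :: b :: t)) ↔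
          (0 < s ∧ s ≤ a - 1) ∨ ∃ u ∈ partialSums (hoffmanDual (b :: t)), s = a + u := by
        intro s
        rw [hoffmanDual, partialSums_replicate_append _ _ hne']
        refine or_congr Iff.rfl ?_
        constructor
        · rintro ⟨u, hu, rfl⟩
          obtain ⟨v, hv, rfl⟩ := (partialSums_plusHead _ hne u).1 hu
          exact ⟨v, hv, by omega⟩
        · rintro ⟨v, hv, rfl⟩
          exact ⟨v + 1, (partialSums_plusHead _ hne _).2 ⟨v, hv, rfl⟩, by omega⟩
      have hpos : 0 < (b :: t).sum := by
        have := hp' b (by simp)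
        simp only [List.sum_cons]; omega
      refine ⟨?_, ?_, fun s => ?_, fun s => ?_⟩
      · intro x hx
        rw [hoffmanDual, List.mem_append] at hx
        rcases hx with hx | hx
        · rw [List.mem_replicate] at hx; omega
        · exact plusHead_pos _ i1 x hx
      · rw [hoffmanDual, List.sum_append, sum_plusHead _ hne, i2, List.sum_cons (a := a)]
        simp only [List.sum_replicate, smul_eq_mul, mul_one]
        omega
      · rw [key, partialSums_cons _ _ (by simp), List.sum_cons (a := a)]
        constructor
        · rintro ((rfl | ⟨u, hu, rfl⟩) | (h | ⟨u, hu, rfl⟩))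
          · omega
          · have := (i3 u).1 (Or.inl hu); omega
          · omega
          · have := (i3 u).1 (Or.inr hu); omega
        · rintro ⟨h0, h1⟩
          rcases lt_trichotomy s a with h | h | h
          · right; left; omega
          · left; left; exact h
          · rcases (i3 (s - a)).2 ⟨by omega, by omega⟩ with h | h
            · exact Or.inl (Or.inr ⟨_, h, by omega⟩)
            · exact Or.inr (Or.inr ⟨_, h, by omega⟩)
      · rw [key, partialSums_cons _ _ (by simp)]
        rintro ⟨h1, h2⟩
        rcases h1 with rfl | ⟨u, hu, rfl⟩ <;> rcases h2 with h | ⟨v, hv, h⟩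
        · omega
        · have := (i3 v).1 (Or.inr hv); omega
        · omega
        · obtain rfl : u = v := by omega
          exact i4 u ⟨hu, hv⟩

end HurwitzStar

/-! Write L_k(x) = Li_k(x/(x-1)) and J_k(n) = ∫₀¹ L_k(x) (1-x)^(n-α-1) dx for Re α < 1 and n ≥ 1.
Under t = x/(x-1) the form dt/(1-t) becomes -dx/(1-x), and dt/t becomes dx/(x(1-x)). Integration by
parts in J_k(n) therefore removes the outermost form and divides by n-α. Removing dt/(1-t) costs a
sign. Removing dt/t leaves a factor 1/x = ∑_{N≥0} (1-x)^N, which turns the integral into ∑_N J(n+N).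

Starting from 1/(n-α) for the empty composition, each form dt/(1-t) thus raises the exponent of the
smallest summation variable by one, and each form dt/t inserts a new smallest variable with exponent
1. This is `integral_landenPolylog`. One more expansion of 1/x, at n = 1, yields the full star sum
in `integral_integrand`. The exponent list so produced is the reversed index of the theorem by
`plusHead_hoffmanDual_reverse`.

The analytic input is that L_k grows more slowly than any negative power of 1-x
(`exists_landenPolylog_bound`), which kills the boundary term at 1 and justifies exchanging sum and
integral. For the continuation, the star series converges locally uniformly on ℂ ∖ {1, 2, …}, which
is open and connected, so the identity theorem applies. The power series of Li_k is obtained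
separately, by termwise integration. -/

namespace HurwitzStar

open Filter Topology
/-! ### Combinatorics of compositions -/

/-- Induction on compositions following the iterated integral from the inside to the outside. -/
theorem composition_induction {P : List ℕ → Prop} (nil : P [])
    (one_cons : ∀ t, (∀ a ∈ t, 0 < a) → P t → P (1 :: t))
    (succ_cons : ∀ a t, 0 < a → (∀ b ∈ t, 0 < b) → P (a :: t) → P ((a + 1) :: t)) :
    ∀ k : List ℕ, (∀ a ∈ k, 0 < a) → P k
  | [], _ => nil
  | a :: t, h => by
      have ht : ∀ b ∈ t, 0 < b := fun b hb => h b (List.mem_cons_of_mem _ hb)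
      have ih := composition_induction nil one_cons succ_cons t ht
      have ha : 1 ≤ a := h a (by simp)
      clear h
      induction a, ha using Nat.le_induction with
      | base => exact one_cons t ht ih
      | succ a ha iha => exact succ_cons a t ha ht iha

/-- The exponents `(m_s, …, m₁)` of the star value attached to a composition, read from the
smallest summation variable to the largest one. -/
def exponents : List ℕ → List ℕ
  -- This matches ∫₀¹ (1-x)^(n-α-1) dx = 1/(n-α).
  | [] => [1]
  | a :: t => List.replicate (a - 1) 1 ++ plusHead (exponents t)

theorem plusHead_ne_nil {l : List ℕ} (h : l ≠ []) : plusHead l ≠ [] := by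
  cases l <;> simp_all [plusHead]

theorem exponents_ne_nil : ∀ k : List ℕ, exponents k ≠ []
  | [] => by simp [exponents]
  | a :: t => by simp [exponents, plusHead_ne_nil (exponents_ne_nil t)]

/-- This and `exponents_succ_cons` mirror the two integration by parts rules: a new form dt/(1-t)
contributes a factor 1/(n-α), a new form dt/t contributes a new smallest summation variable. -/
theorem exponents_one_cons (t : List ℕ) : exponents (1 :: t) = plusHead (exponents t) := by
  simp [exponents]

theorem exponents_succ_cons {a : ℕ} (ha : 0 < a) (t : List ℕ) :
    exponents ((a + 1) :: t) = 1 :: exponents (a :: t) := by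
  obtain ⟨b, rfl⟩ : ∃ b, a = b + 1 := ⟨a - 1, by omega⟩
  simp [exponents, List.replicate_succ]

/-- Increase the last entry by one. -/
def plusLast (l : List ℕ) : List ℕ := (plusHead l.reverse).reverse

theorem plusHead_append {x : List ℕ} (hx : x ≠ []) (y : List ℕ) :
    plusHead (x ++ y) = plusHead x ++ y := by
  cases x <;> simp_all [plusHead]

theorem plusLast_append (x : List ℕ) {y : List ℕ} (hy : y ≠ []) :
    plusLast (x ++ y) = x ++ plusLast y := by
  simp [plusLast, plusHead_append, hy]

theorem plusLast_ne_nil {l : List ℕ} (h : l ≠ []) : plusLast l ≠ [] := by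
  simpa [plusLast] using plusHead_ne_nil (l := l.reverse) (by simpa using h)

theorem plusHead_plusLast (l : List ℕ) : plusHead (plusLast l) = plusLast (plusHead l) := by
  rcases l with _ | ⟨a, l⟩
  · rfl
  rcases eq_or_ne l [] with rfl | h
  · rfl
  · have h1 := plusLast_append [a] h
    have h2 := plusLast_append [a + 1] h
    simp only [List.singleton_append] at h1 h2
    simp [plusHead, h1, h2]

theorem plusHead_replicate_one {a : ℕ} (ha : 0 < a) :
    plusHead (List.replicate a 1) = 2 :: List.replicate (a - 1) 1 := by
  obtain ⟨b, rfl⟩ : ∃ b, a = b + 1 := ⟨a - 1, by omega⟩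
  simp [plusHead, List.replicate_succ]

/-- Duality swaps commas and plus signs. The new comma before `a` becomes a plus sign that enlarges
the last entry of the dual, and the `a - 1` plus signs inside `a` become commas. -/
theorem hoffmanDual_append_singleton {a : ℕ} (ha : 0 < a) :
    ∀ l : List ℕ, l ≠ [] → (∀ b ∈ l, 0 < b) →
      hoffmanDual (l ++ [a]) = plusLast (hoffmanDual l) ++ List.replicate (a - 1) 1
  | [], h, _ => absurd rfl h
  | [b], _, hp => by
      have hb : 0 < b := hp b (by simp)
      simp only [List.singleton_append, hoffmanDual, plusLast, List.reverse_replicate,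
        plusHead_replicate_one ha, plusHead_replicate_one hb]
      simp
  | b :: c :: t, _, hp => by
      have hp' : ∀ x ∈ c :: t, 0 < x := fun x hx => hp x (List.mem_cons_of_mem _ hx)
      have hne := hoffmanDual_ne_nil (c :: t) (by simp) hp'
      have ih := hoffmanDual_append_singleton ha (c :: t) (by simp) hp'
      rw [List.cons_append] at ih
      simp only [List.cons_append, hoffmanDual]
      rw [ih, plusHead_append (plusLast_ne_nil hne), plusHead_plusLast,
        plusLast_append _ (plusHead_ne_nil hne), List.append_assoc]

/-- Both lists can be built by peeling off the head of `k`: for `exponents` by definition, and for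
the dual of the reversal because that head is its last part, where `hoffmanDual_append_singleton`
applies. -/
theorem plusHead_hoffmanDual_reverse : ∀ k : List ℕ, k ≠ [] → (∀ a ∈ k, 0 < a) →
    plusHead (hoffmanDual k.reverse) = (exponents k).reverse
  | [], h, _ => absurd rfl h
  | [a], _, hp => by
      rw [List.reverse_singleton, hoffmanDual, plusHead_replicate_one (hp a (by simp))]
      simp [exponents, plusHead]
  | a :: b :: t, _, hp => by
      have hp' : ∀ x ∈ b :: t, 0 < x := fun x hx => hp x (List.mem_cons_of_mem _ hx)
      have hne := hoffmanDual_ne_nil (b :: t).reverse (by simp) (fun x hx => hp' x (List.mem_reverse.1 hx))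
      rw [List.reverse_cons, hoffmanDual_append_singleton (hp a (by simp)) _ (by simp)
        (fun x hx => hp' x (List.mem_reverse.1 hx)), plusHead_append (plusLast_ne_nil hne),
        plusHead_plusLast, plusHead_hoffmanDual_reverse (b :: t) (by simp) hp', plusLast,
        List.reverse_reverse, exponents.eq_2 a (b :: t), List.reverse_append, List.reverse_replicate]

/-! ### Nested sums over tuples of natural numbers -/

/-- Tuples with entries in `p`, any two of which, taken in order, are related by `ρ`. -/
abbrev NestedTuples (ρ : ℕ → ℕ → Prop) (p : Set ℕ) (r : ℕ) : Type :=
  {n : Fin r → ℕ // (∀ i j, i < j → ρ (n i) (n j)) ∧ ∀ i, n i ∈ p}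

/-- Splitting off the first entry of a nested tuple. -/
def NestedTuples.consEquiv (ρ : ℕ → ℕ → Prop) (p : Set ℕ) (r : ℕ) :
    (Σ M : p, NestedTuples ρ (p ∩ {M' | ρ M M'}) r) ≃ NestedTuples ρ p (r + 1) where
  toFun x := ⟨Fin.cons (x.1 : ℕ) x.2.1, by
    refine ⟨fun i j hij => ?_, fun i => ?_⟩
    · induction j using Fin.cases with
      | zero => exact absurd hij (Fin.not_lt_zero i)
      | succ j =>
        induction i using Fin.cases with
        | zero => simpa using (x.2.2.2 j).2
        | succ i => simpa using x.2.2.1 i j (by simpa using hij)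
    · induction i using Fin.cases with
      | zero => exact x.1.2
      | succ i => simpa using (x.2.2.2 i).1⟩
  invFun n := ⟨⟨n.1 0, n.2.2 0⟩, ⟨Fin.tail n.1,
    fun i j hij => n.2.1 i.succ j.succ (by simpa using hij),
    fun i => ⟨n.2.2 i.succ, n.2.1 0 i.succ (Fin.succ_pos i)⟩⟩⟩
  left_inv _ := rfl
  right_inv n := by simp

section NestedSum

variable {𝕜 : Type*} [NormedField 𝕜]

/-- `∑_{n₁} w₁(n₁) ∑_{n₂} w₂(n₂) ⋯` over tuples in `p` with entries related by `ρ`. -/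
noncomputable def nestedSum (ρ : ℕ → ℕ → Prop) : List (ℕ → 𝕜) → Set ℕ → 𝕜
  | [], _ => 1
  | w :: ws, p => ∑' M : p, w M * nestedSum ρ ws (p ∩ {M' | ρ M M'})

theorem hasSum_nestedTuples_succ [CompleteSpace 𝕜] (ρ : ℕ → ℕ → Prop) {r : ℕ} (w : ℕ → 𝕜)
    (g : (Fin r → ℕ) → 𝕜) (S : Set ℕ → 𝕜)
    (hS : ∀ q, Summable (fun n : NestedTuples ρ q r => g n.1) →
      HasSum (fun n : NestedTuples ρ q r => g n.1) (S q)) (p : Set ℕ)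
    (h : Summable (fun n : NestedTuples ρ p (r + 1) => w (n.1 0) * g (Fin.tail n.1))) :
    HasSum (fun n : NestedTuples ρ p (r + 1) => w (n.1 0) * g (Fin.tail n.1))
      (∑' M : p, w M * S (p ∩ {M' | ρ M M'})) := by
  have h' := (NestedTuples.consEquiv ρ p r).summable_iff.2 h
  refine (NestedTuples.consEquiv ρ p r).hasSum_iff.1 ?_
  have hfun : (fun n : NestedTuples ρ p (r + 1) => w (n.1 0) * g (Fin.tail n.1)) ∘
      NestedTuples.consEquiv ρ p r = fun x => w x.1 * g x.2.1 := rfl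
  rw [hfun] at h' ⊢
  have hfib : ∀ M : p, HasSum (fun n : NestedTuples ρ (p ∩ {M' | ρ M M'}) r => w M * g n.1)
      (w M * S (p ∩ {M' | ρ M M'})) := by
    intro M
    -- When the weight vanishes the inner family need not be summable, so its sum carries no
    -- information; but then both sides are zero.
    by_cases hM : w M = 0
    · simpa only [hM, zero_mul] using hasSum_zero
    · exact (hS _ ((summable_mul_left_iff hM).1 (h'.sigma_factor M))).mul_left _
  rw [(h'.hasSum.sigma hfib).tsum_eq]
  exact h'.hasSum

/-- An absolutely convergent sum over nested tuples is the iterated sum. -/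
theorem hasSum_nestedSum [CompleteSpace 𝕜] (ρ : ℕ → ℕ → Prop) : ∀ {r : ℕ} (W : Fin r → ℕ → 𝕜)
    (p : Set ℕ), Summable (fun n : NestedTuples ρ p r => ∏ i, W i (n.1 i)) →
    HasSum (fun n : NestedTuples ρ p r => ∏ i, W i (n.1 i)) (nestedSum ρ (List.ofFn W) p)
  | 0, W, p, _ => by
      have : Unique (NestedTuples ρ p 0) :=
        { default := ⟨Fin.elim0, fun i => i.elim0, fun i => i.elim0⟩
          uniq := fun n => Subtype.ext (funext fun i => i.elim0) }
      simpa only [List.ofFn_zero, nestedSum, Finset.univ_eq_empty, Finset.prod_empty] using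
        hasSum_unique (fun n : NestedTuples ρ p 0 => (1 : 𝕜))
  | r + 1, W, p, h => by
      simp only [Fin.prod_univ_succ] at h ⊢
      rw [List.ofFn_succ]
      exact hasSum_nestedTuples_succ ρ (W 0) (fun n => ∏ i : Fin r, W i.succ (n i)) _
        (hasSum_nestedSum ρ fun i => W i.succ) p h

end NestedSum

/-- Products of a summable nonnegative sequence are summable over all tuples. -/
theorem summable_prod_tuples {f : ℕ → ℝ} (h0 : ∀ n, 0 ≤ f n) (hf : Summable f) (r : ℕ) :
    Summable (fun n : Fin r → ℕ => ∏ i, f (n i)) := by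
  refine summable_of_sum_le (c := (∑' n, f n) ^ r)
    (fun n => Finset.prod_nonneg fun i _ => h0 _) (fun u => ?_)
  -- Enclose the finite set in the box spanned by its coordinate projections: over a box the sum of
  -- products factorizes.
  have hsub : u ⊆ Fintype.piFinset (fun i : Fin r => u.image (fun n => n i)) := by
    intro n hn
    simp only [Fintype.mem_piFinset, Finset.mem_image]
    exact fun i => ⟨n, hn, rfl⟩
  calc ∑ n ∈ u, ∏ i, f (n i)
      ≤ ∑ n ∈ Fintype.piFinset (fun i : Fin r => u.image (fun n => n i)), ∏ i, f (n i) :=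
        Finset.sum_le_sum_of_subset_of_nonneg hsub
          (fun n _ _ => Finset.prod_nonneg fun i _ => h0 _)
    _ = ∏ i : Fin r, ∑ m ∈ u.image (fun n => n i), f m := by
        rw [Finset.prod_univ_sum]
    _ ≤ ∏ _i : Fin r, ∑' n, f n :=
        Finset.prod_le_prod (fun i _ => Finset.sum_nonneg fun m _ => h0 m)
          (fun i _ => hf.sum_le_tsum _ (fun m _ => h0 m))
    _ = (∑' n, f n) ^ r := by simp

/-! ### Termwise integration of power series -/

theorem abs_le_abs_of_mem_uIoc {u z : ℝ} (hu : u ∈ Set.uIoc 0 z) : |u| ≤ |z| := by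
  rcases le_total 0 z with h | h
  · rw [uIoc_of_le h] at hu
    rw [abs_of_pos hu.1, abs_of_nonneg h]; exact hu.2
  · rw [uIoc_of_ge h] at hu
    rw [abs_of_nonpos hu.2, abs_of_nonpos h]; linarith [hu.1]

/-- The point u = 0 is exempt because the lemma is also applied to Li(u)/u, whose value at 0 is 0 by
the division convention and not the limit. -/
theorem hasSum_integral_pow {a : ℕ → ℝ} {f : ℝ → ℝ} {z : ℝ}
    (hs : Summable fun n => |a n| * |z| ^ n)
    (hf : ∀ u, u ≠ 0 → |u| ≤ |z| → HasSum (fun n => a n * u ^ n) (f u)) :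
    HasSum (fun n => a n / (n + 1) * z ^ (n + 1)) (∫ u in (0 : ℝ)..z, f u) := by
  have h := intervalIntegral.hasSum_integral_of_dominated_convergence (μ := volume) (a := 0)
    (b := z) (F := fun n u => a n * u ^ n) (f := f) (fun n _ => |a n| * |z| ^ n)
    (fun n => by fun_prop)
    (fun n => Eventually.of_forall fun u hu => by
      rw [norm_mul, norm_pow, Real.norm_eq_abs, Real.norm_eq_abs]
      exact mul_le_mul_of_nonneg_left
        (pow_le_pow_left₀ (abs_nonneg u) (abs_le_abs_of_mem_uIoc hu) n) (abs_nonneg _))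
    (Eventually.of_forall fun u _ => hs) intervalIntegrable_const
    (by
      filter_upwards [compl_mem_ae_iff.2 (measure_singleton (0 : ℝ))] with u hu hu'
      exact hf u hu (abs_le_abs_of_mem_uIoc hu'))
  refine h.congr_fun fun n => ?_
  rw [intervalIntegral.integral_const_mul, integral_pow]
  simp
  ring

/-- Primitives of analytic functions of a real variable are analytic. -/
theorem analyticAt_of_eventually_eq_integral {f g : ℝ → ℝ} {x : ℝ} (hf : AnalyticAt ℝ f x)
    (hg : ∀ᶠ z in 𝓝 (0 : ℝ), g (x + z) = g x + ∫ u in (0 : ℝ)..z, f (x + u)) :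
    AnalyticAt ℝ g x := by
  obtain ⟨p, hp⟩ := hf
  rw [hasFPowerSeriesAt_iff] at hp
  obtain ⟨r, hr, hp⟩ := Metric.eventually_nhds_iff.1 hp
  let c : ℕ → ℝ := fun n => Nat.casesOn n (g x) fun n => p.coeff n / (n + 1)
  refine ⟨FormalMultilinearSeries.ofScalars ℝ c, hasFPowerSeriesAt_iff.2 ?_⟩
  filter_upwards [hg, Metric.ball_mem_nhds 0 hr] with z hz hzr
  have hzr : |z| < r := by simpa using hzr
  have hp' : ∀ u, |u| < r → HasSum (fun n => p.coeff n * u ^ n) (f (x + u)) := by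
    intro u hu
    simpa only [smul_eq_mul, mul_comm] using hp (y := u) (by simpa using hu)
  have h := hasSum_integral_pow (a := fun n => p.coeff n) (f := fun u => f (x + u)) (z := z)
    (by simpa only [abs_mul, abs_pow] using (hp' z hzr).summable.abs)
    (fun u _ hu => hp' u (hu.trans_lt hzr))
  simp only [FormalMultilinearSeries.coeff_ofScalars, smul_eq_mul]
  rw [← hasSum_nat_add_iff' 1, hz]
  simpa [c, mul_comm] using h

theorem intervalIntegrable_of_continuousOn_Iio {f : ℝ → ℝ} (hf : ContinuousOn f (Iio 1)) {x y : ℝ}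
    (hx : x < 1) (hy : y < 1) : IntervalIntegrable f volume x y :=
  (hf.mono (ordConnected_Iio.uIcc_subset hx hy)).intervalIntegrable

theorem analyticOnNhd_integral {f : ℝ → ℝ} (hf : AnalyticOnNhd ℝ f (Iio 1)) :
    AnalyticOnNhd ℝ (fun z => ∫ u in (0 : ℝ)..z, f u) (Iio 1) := by
  intro x hx
  refine analyticAt_of_eventually_eq_integral (hf x hx) ?_
  have : ∀ᶠ z in 𝓝 (0 : ℝ), x + z < 1 := by
    have : Tendsto (fun z => x + z) (𝓝 0) (𝓝 (x + 0)) :=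
      tendsto_const_nhds.add tendsto_id
    exact this.eventually (Iio_mem_nhds (by simpa using hx))
  filter_upwards [this] with z hz
  rw [intervalIntegral.integral_comp_add_left (fun u => f u), add_zero,
    intervalIntegral.integral_add_adjacent_intervals
      (intervalIntegrable_of_continuousOn_Iio hf.continuousOn one_pos hx)
      (intervalIntegrable_of_continuousOn_Iio hf.continuousOn hx hz)]

theorem hasDerivAt_integral_of_continuousOn_Iio {f : ℝ → ℝ} (hf : ContinuousOn f (Iio 1)) {z : ℝ}
    (hz : z < 1) : HasDerivAt (fun z => ∫ u in (0 : ℝ)..z, f u) (f z) z :=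
  intervalIntegral.integral_hasDerivAt_right
    (intervalIntegrable_of_continuousOn_Iio hf one_pos hz)
    (hf.stronglyMeasurableAtFilter isOpen_Iio z hz) (hf.continuousAt (Iio_mem_nhds hz))

/-! ### The multiple polylogarithm on `(-∞, 1)` -/

theorem multiPolylog_one_cons (t : List ℕ) :
    multiPolylog (1 :: t) = fun z => ∫ u in (0 : ℝ)..z, multiPolylog t u / (1 - u) := rfl

theorem multiPolylog_succ_cons {a : ℕ} (ha : 0 < a) (t : List ℕ) :
    multiPolylog ((a + 1) :: t) = fun z => ∫ u in (0 : ℝ)..z, multiPolylog (a :: t) u / u := by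
  obtain ⟨b, rfl⟩ : ∃ b, a = b + 1 := ⟨a - 1, by omega⟩
  simp only [multiPolylog, Nat.add_sub_cancel, Function.iterate_succ_apply']

theorem multiPolylog_zero {k : List ℕ} (hk : k ≠ []) (hpos : ∀ a ∈ k, 0 < a) :
    multiPolylog k 0 = 0 := by
  revert hk
  refine composition_induction (P := fun k => k ≠ [] → multiPolylog k 0 = 0) (fun h => absurd rfl h)
    (fun t _ _ _ => ?_) (fun a t ha _ _ _ => ?_) k hpos
  · simp [multiPolylog_one_cons]
  · simp [multiPolylog_succ_cons ha]

/-- Replaces f(u)/u by its analytic extension through 0, so that the results on primitives of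
analytic functions apply. -/
theorem integral_div_eq_integral_dslope {f : ℝ → ℝ} (h0 : f 0 = 0) (z : ℝ) :
    ∫ u in (0 : ℝ)..z, f u / u = ∫ u in (0 : ℝ)..z, dslope f 0 u := by
  refine intervalIntegral.integral_congr_ae ?_
  filter_upwards [compl_mem_ae_iff.2 (measure_singleton (0 : ℝ))] with u hu _
  rw [dslope_of_ne _ hu, slope_def_field, h0]
  simp

theorem analyticOnNhd_dslope {f : ℝ → ℝ} (hf : AnalyticOnNhd ℝ f (Iio 1)) :
    AnalyticOnNhd ℝ (dslope f 0) (Iio 1) := by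
  intro x hx
  rcases eq_or_ne x 0 with rfl | h
  · obtain ⟨p, hp⟩ := hf 0 hx
    exact ⟨_, hp.has_fpower_series_dslope_fslope⟩
  · have : AnalyticAt ℝ (fun u => (f u - f 0) / (u - 0)) x :=
      ((hf x hx).sub analyticAt_const).div (analyticAt_id.sub analyticAt_const) (by simpa using h)
    refine this.congr ?_
    filter_upwards [isOpen_ne.mem_nhds h] with u hu
    rw [dslope_of_ne _ hu, slope_def_field]

theorem AnalyticOnNhd.div_one_sub {f : ℝ → ℝ} (hf : AnalyticOnNhd ℝ f (Iio 1)) :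
    AnalyticOnNhd ℝ (fun u => f u / (1 - u)) (Iio 1) := fun x hx =>
  (hf x hx).div (analyticAt_const.sub analyticAt_id) (by
    have : x < 1 := hx
    simpa using (sub_pos.2 this).ne')

theorem analyticOnNhd_multiPolylog {k : List ℕ} (hpos : ∀ a ∈ k, 0 < a) :
    AnalyticOnNhd ℝ (multiPolylog k) (Iio 1) := by
  refine composition_induction (P := fun k => AnalyticOnNhd ℝ (multiPolylog k) (Iio 1))
    analyticOnNhd_const (fun t _ h => ?_) (fun a t ha ht h => ?_) k hpos
  · exact analyticOnNhd_integral (AnalyticOnNhd.div_one_sub h)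
  · rw [multiPolylog_succ_cons ha]
    simp only [integral_div_eq_integral_dslope
      (multiPolylog_zero (k := a :: t) (by simp) (by simpa using ⟨ha, ht⟩))]
    exact analyticOnNhd_integral (analyticOnNhd_dslope h)

theorem hasDerivAt_multiPolylog_one_cons {t : List ℕ} (ht : ∀ a ∈ t, 0 < a) {z : ℝ} (hz : z < 1) :
    HasDerivAt (multiPolylog (1 :: t)) (multiPolylog t z / (1 - z)) z :=
  hasDerivAt_integral_of_continuousOn_Iio
    (AnalyticOnNhd.div_one_sub (analyticOnNhd_multiPolylog ht)).continuousOn hz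

theorem hasDerivAt_multiPolylog_succ_cons {a : ℕ} {t : List ℕ} (ha : 0 < a) (ht : ∀ b ∈ t, 0 < b)
    {z : ℝ} (hz : z < 1) (hz0 : z ≠ 0) :
    HasDerivAt (multiPolylog ((a + 1) :: t)) (multiPolylog (a :: t) z / z) z := by
  have hpos : ∀ b ∈ a :: t, 0 < b := by simpa using ⟨ha, ht⟩
  have h0 := multiPolylog_zero (by simp) hpos
  rw [multiPolylog_succ_cons ha]
  simp only [integral_div_eq_integral_dslope h0]
  have := hasDerivAt_integral_of_continuousOn_Iio
    (analyticOnNhd_dslope (analyticOnNhd_multiPolylog hpos)).continuousOn hz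
  rwa [dslope_of_ne _ hz0, slope_def_field, h0, sub_zero, sub_zero] at this

/-! ### The power series of the multiple polylogarithm -/

/-- The Taylor coefficients of the multiple polylogarithm at the origin. -/
noncomputable def polylogCoeff : List ℕ → ℕ → ℝ
  | [], N => if N = 0 then 1 else 0
  | a :: t, N => (∑ M ∈ Finset.range N, polylogCoeff t M) / (N : ℝ) ^ a

theorem polylogCoeff_cons_zero (a : ℕ) (t : List ℕ) : polylogCoeff (a :: t) 0 = 0 := by
  simp [polylogCoeff]

theorem polylogCoeff_nonneg : ∀ (k : List ℕ) (N : ℕ), 0 ≤ polylogCoeff k N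
  | [], N => by rw [polylogCoeff]; split_ifs <;> simp
  | a :: t, N => div_nonneg (Finset.sum_nonneg fun M _ => polylogCoeff_nonneg t M) (by positivity)

theorem sum_range_le_of_le_one {c : ℕ → ℝ} (h : ∀ n, c n ≤ 1) (N : ℕ) :
    ∑ M ∈ Finset.range N, c M ≤ N := by
  simpa using Finset.sum_le_sum (s := Finset.range N) fun M _ => h M

theorem polylogCoeff_le_one : ∀ (k : List ℕ), (∀ a ∈ k, 0 < a) → ∀ N, polylogCoeff k N ≤ 1
  | [], _, N => by rw [polylogCoeff]; split_ifs <;> simp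
  | a :: t, h, N => by
      rw [polylogCoeff]
      refine div_le_one_of_le₀ ((sum_range_le_of_le_one (polylogCoeff_le_one t fun b hb =>
        h b (List.mem_cons_of_mem _ hb)) N).trans ?_) (by positivity)
      exact_mod_cast Nat.le_self_pow (h a (by simp)).ne' N

theorem summable_succ_mul_pow {z : ℝ} (hz : |z| < 1) :
    Summable fun n : ℕ => ((n : ℝ) + 1) * |z| ^ n := by
  have h1 := summable_pow_mul_geometric_of_norm_lt_one 1 (r := |z|) (by simpa using hz)
  have h2 := summable_geometric_of_lt_one (abs_nonneg z) hz
  simpa [add_mul] using h1.add h2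

/-- Division by 1-u is a Cauchy product with the geometric series, so it replaces coefficients by
their partial sums; division by u shifts them. The bound `polylogCoeff_le_one` suffices for termwise
integration. -/
theorem hasSum_multiPolylog {k : List ℕ} (hpos : ∀ a ∈ k, 0 < a) :
    ∀ z : ℝ, |z| < 1 → HasSum (fun N => polylogCoeff k N * z ^ N) (multiPolylog k z) := by
  refine composition_induction
    (P := fun k => ∀ z : ℝ, |z| < 1 → HasSum (fun N => polylogCoeff k N * z ^ N) (multiPolylog k z))
    (fun z _ => ?_) (fun t ht ih z hz => ?_) (fun a t ha ht ih z hz => ?_) k hpos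
  · have := hasSum_ite_eq (0 : ℕ) (1 : ℝ)
    refine this.congr_fun fun N => ?_
    by_cases h : N = 0 <;> simp [polylogCoeff, h]
  · rw [← hasSum_nat_add_iff' 1]
    have hc1 := polylogCoeff_le_one t ht
    have hc0 := polylogCoeff_nonneg t
    -- The partial sums of the integrand run over M ≤ N; integration raises the index by one, which
    -- produces the strict inequality M < N of `polylogCoeff`.
    have h := hasSum_integral_pow (z := z) (f := fun u => multiPolylog t u / (1 - u))
      (a := fun N => ∑ M ∈ Finset.range (N + 1), polylogCoeff t M) ?_ ?_
    · simpa [polylogCoeff, multiPolylog_one_cons] using h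
    · refine (summable_succ_mul_pow hz).of_nonneg_of_le (fun n => by positivity) (fun n => ?_)
      rw [abs_of_nonneg (Finset.sum_nonneg fun M _ => hc0 M)]
      gcongr
      exact_mod_cast sum_range_le_of_le_one hc1 (n + 1)
    · intro u _ hu
      have hu1 : |u| < 1 := hu.trans_lt hz
      have hg : HasSum (fun n => u ^ n) (1 - u)⁻¹ := hasSum_geometric_of_abs_lt_one hu1
      have := hasSum_sum_range_mul_of_summable_norm (ih u hu1).summable.norm hg.summable.norm
      rw [(ih u hu1).tsum_eq, hg.tsum_eq, ← div_eq_mul_inv] at this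
      refine this.congr_fun fun N => ?_
      rw [Finset.sum_mul]
      refine Finset.sum_congr rfl fun M hM => ?_
      rw [mul_assoc, ← pow_add, Nat.add_sub_cancel' (Nat.lt_succ_iff.1 (Finset.mem_range.1 hM))]
  · rw [← hasSum_nat_add_iff' 1]
    have hpos' : ∀ b ∈ a :: t, 0 < b := by simpa using ⟨ha, ht⟩
    have hc1 := polylogCoeff_le_one _ hpos'
    have hc0 := polylogCoeff_nonneg (a :: t)
    have h := hasSum_integral_pow (z := z) (f := fun u => multiPolylog (a :: t) u / u)
      (a := fun N => polylogCoeff (a :: t) (N + 1)) ?_ ?_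
    · rw [multiPolylog_succ_cons ha, Finset.sum_range_one, polylogCoeff_cons_zero, zero_mul,
        sub_zero]
      refine h.congr_fun fun N => ?_
      simp only [polylogCoeff, pow_succ, Nat.cast_succ, div_div]
    · refine (summable_succ_mul_pow hz).of_nonneg_of_le (fun n => by positivity) (fun n => ?_)
      rw [abs_of_nonneg (hc0 _)]
      gcongr
      exact (hc1 _).trans (by simp)
    · intro u hu0 hu
      have := (hasSum_nat_add_iff' 1).2 (ih u (hu.trans_lt hz))
      simp only [Finset.sum_range_one, polylogCoeff_cons_zero, zero_mul, sub_zero] at this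
      refine (this.div_const u).congr_fun fun N => ?_
      rw [pow_succ, ← mul_assoc, mul_div_cancel_right₀ _ hu0]

/-! ### The multiple polylogarithm as a sum over strict tuples -/

/-- The index M = 0 on the right contributes only for the empty list, where the coefficient 1 stands
for the empty inner sum. This is why `0 < N` is required. -/
theorem nestedSum_gt_Ioo : ∀ (t : List ℕ) (N : ℕ), 0 < N →
    nestedSum (fun a b => b < a) (t.map fun e (M : ℕ) => 1 / (M : ℝ) ^ e) (Ioo 0 N) =
      ∑ M ∈ Finset.range N, polylogCoeff t M
  | [], N, hN => by simp [nestedSum, polylogCoeff, hN.ne']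
  | a :: t, N, _ => by
      have h : ∀ M : Ioo 0 N, 1 / ((M : ℕ) : ℝ) ^ a *
          nestedSum (fun a b => b < a) (t.map fun e (M : ℕ) => 1 / (M : ℝ) ^ e)
            (Ioo 0 N ∩ {M' | M' < (M : ℕ)}) = polylogCoeff (a :: t) M := by
        intro M
        have hs : Ioo 0 N ∩ {M' | M' < (M : ℕ)} = Ioo 0 (M : ℕ) := by
          ext x
          have := M.2.2
          simp only [mem_inter_iff, mem_Ioo, mem_ofPred_eq]
          omega
        rw [hs, nestedSum_gt_Ioo t M M.2.1, polylogCoeff]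
        ring
      rw [List.map_cons, nestedSum, tsum_congr h, tsum_subtype (Ioo 0 N) (polylogCoeff (a :: t)),
        tsum_eq_sum (s := Finset.range N)]
      · refine Finset.sum_congr rfl fun M hM => ?_
        rcases Nat.eq_zero_or_pos M with rfl | h0
        · simp [polylogCoeff_cons_zero]
        · rw [indicator_of_mem (mem_Ioo.2 ⟨h0, Finset.mem_range.1 hM⟩)]
      · intro M hM
        rw [indicator_of_notMem]
        exact fun h => hM (Finset.mem_range.2 h.2)

theorem exists_pow_le_of_abs_lt_one {z : ℝ} (hz : |z| < 1) (m : ℕ) :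
    ∃ C, 0 ≤ C ∧ ∀ N : ℕ, 0 < N → |z| ^ N ≤ C * (1 / (N : ℝ) ^ m) := by
  have h := summable_pow_mul_geometric_of_norm_lt_one m (r := |z|) (by simpa using hz)
  refine ⟨∑' n : ℕ, (n : ℝ) ^ m * |z| ^ n, tsum_nonneg fun n => by positivity, fun N hN => ?_⟩
  have := h.le_tsum N fun n _ => by positivity
  rw [mul_one_div, le_div_iff₀ (by positivity)]
  linarith

/-- The factor |z|^n₁ is O(n₁^(-2r)), with r the length of `k`. Since n₁ is the largest entry, this
can be shared out as one factor n_i^(-2) per variable. -/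
theorem summable_polylogTerm {k : List ℕ} (hk : 0 < k.length) {z : ℝ} (hz : |z| < 1) :
    Summable (polylogTerm k hk z) := by
  obtain ⟨C, hC, h⟩ := exists_pow_le_of_abs_lt_one hz (2 * k.length)
  have hs := (summable_prod_tuples (f := fun n : ℕ => 1 / (n : ℝ) ^ 2) (fun n => by positivity)
    (Real.summable_one_div_nat_pow.2 one_lt_two) k.length).comp_injective
      (Subtype.val_injective (p := fun n : Fin k.length → ℕ => StrictAnti n ∧ ∀ i, 0 < n i))
  refine (hs.mul_left C).of_norm_bounded fun n => ?_
  have h1 : 1 ≤ ∏ i, (n.1 i : ℝ) ^ k.get i := by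
    refine Finset.prod_induction _ (fun x : ℝ => 1 ≤ x) (fun _ _ => one_le_mul_of_one_le_of_one_le)
      le_rfl fun i _ => one_le_pow₀ ?_
    exact_mod_cast n.2.2 i
  rw [polylogTerm, norm_div, norm_pow, Real.norm_eq_abs, Real.norm_eq_abs,
    abs_of_nonneg (zero_le_one.trans h1)]
  refine (div_le_self (by positivity) h1).trans ((h _ (n.2.2 _)).trans ?_)
  refine mul_le_mul_of_nonneg_left ?_ hC
  have hp : ∏ _i : Fin k.length, 1 / ((n.1 ⟨0, hk⟩ : ℕ) : ℝ) ^ 2 =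
      1 / ((n.1 ⟨0, hk⟩ : ℕ) : ℝ) ^ (2 * k.length) := by
    simp [pow_mul]
  rw [← hp]
  refine Finset.prod_le_prod (fun i _ => by positivity) fun i _ => ?_
  have : 0 < n.1 i := n.2.2 i
  have h2 : n.1 i ≤ n.1 ⟨0, hk⟩ := n.2.1.antitone (Nat.zero_le i.1)
  gcongr

theorem hasSum_polylogTerm {k : List ℕ} (hk : 0 < k.length) (hpos : ∀ a ∈ k, 0 < a) {z : ℝ}
    (hz : |z| < 1) : HasSum (polylogTerm k hk z) (multiPolylog k z) := by
  obtain ⟨a, t, rfl⟩ := List.exists_cons_of_length_pos hk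
  let W : Fin (t.length + 1) → ℕ → ℝ :=
    Fin.cons (fun M => z ^ M / (M : ℝ) ^ a) fun i M => 1 / (M : ℝ) ^ t.get i
  let e : NestedTuples (fun a b => b < a) (Ioi 0) (t.length + 1) ≃ StrictTuples (t.length + 1) :=
    Equiv.subtypeEquivRight fun n => Iff.rfl
  have hterm : ∀ n : NestedTuples (fun a b => b < a) (Ioi 0) (t.length + 1),
      polylogTerm (a :: t) hk z (e n) = ∏ i, W i (n.1 i) := by
    intro n
    have h : ∏ i, ((n.1 i : ℕ) : ℝ) ^ (a :: t).get i =
        (n.1 0 : ℝ) ^ a * ∏ i : Fin t.length, (n.1 i.succ : ℝ) ^ t.get i :=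
      Fin.prod_univ_succ (fun i : Fin (t.length + 1) => ((n.1 i : ℕ) : ℝ) ^ (a :: t).get i)
    have h' : polylogTerm (a :: t) hk z (e n) =
      z ^ (n.1 0) / ∏ i, ((n.1 i : ℕ) : ℝ) ^ (a :: t).get i := rfl
    rw [h', h, Fin.prod_univ_succ]
    simp only [W, Fin.cons_zero, Fin.cons_succ, Finset.prod_div_distrib, Finset.prod_const_one]
    rw [div_mul_div_comm, mul_one]
  have hs := (e.summable_iff.2 (summable_polylogTerm hk hz)).congr hterm
  have h := hasSum_nestedSum _ W (Ioi 0) hs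
  have hW : List.ofFn W = (fun M : ℕ => z ^ M / (M : ℝ) ^ a) ::
      t.map (fun e (M : ℕ) => 1 / (M : ℝ) ^ e) := by
    rw [List.ofFn_succ]
    simp only [W, Fin.cons_zero, Fin.cons_succ]
    congr 1
    conv_rhs => rw [← List.ofFn_get t, List.map_ofFn]
    rfl
  have hM : ∀ M : Ioi 0, z ^ (M : ℕ) / ((M : ℕ) : ℝ) ^ a *
      nestedSum (fun a b => b < a) (t.map fun e (M : ℕ) => 1 / (M : ℝ) ^ e)
        (Ioi 0 ∩ {M' | M' < (M : ℕ)}) = polylogCoeff (a :: t) M * z ^ (M : ℕ) := by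
    intro M
    have hset : Ioi 0 ∩ {M' | M' < (M : ℕ)} = Ioo 0 (M : ℕ) := rfl
    rw [hset, nestedSum_gt_Ioo t M M.2, polylogCoeff]
    ring
  have hval : nestedSum (fun a b => b < a) (List.ofFn W) (Ioi 0) = multiPolylog (a :: t) z := by
    rw [hW, nestedSum, tsum_congr hM,
      tsum_subtype (Ioi 0) (fun M => polylogCoeff (a :: t) M * z ^ M),
      ← (hasSum_multiPolylog hpos z hz).tsum_eq]
    refine tsum_congr fun M => ?_
    rcases Nat.eq_zero_or_pos M with rfl | h0
    · simp [polylogCoeff_cons_zero]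
    · rw [indicator_of_mem (mem_Ioi.2 h0)]
  rw [hval] at h
  exact e.hasSum_iff.1 (h.congr_fun hterm)

/-! ### The polylogarithm after the substitution `x ↦ x / (x - 1)` -/

/-- `x ↦ Li_k(x / (x - 1))`. -/
noncomputable def landenPolylog (k : List ℕ) (x : ℝ) : ℝ := multiPolylog k (x / (x - 1))

theorem div_sub_one_lt_one {x : ℝ} (hx : x < 1) : x / (x - 1) < 1 := by
  rw [div_lt_one_of_neg (by linarith)]
  linarith

theorem hasDerivAt_div_sub_one {x : ℝ} (hx : x < 1) :
    HasDerivAt (fun x : ℝ => x / (x - 1)) (-1 / (x - 1) ^ 2) x := by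
  have := (hasDerivAt_id x).div ((hasDerivAt_id x).sub_const 1) (sub_ne_zero.2 hx.ne)
  refine this.congr_deriv ?_
  simp only [id]
  ring

theorem landenPolylog_zero {k : List ℕ} (hk : k ≠ []) (hpos : ∀ a ∈ k, 0 < a) :
    landenPolylog k 0 = 0 := by
  simp [landenPolylog, multiPolylog_zero hk hpos]

theorem continuousOn_landenPolylog {k : List ℕ} (hpos : ∀ a ∈ k, 0 < a) :
    ContinuousOn (landenPolylog k) (Iio 1) :=
  (analyticOnNhd_multiPolylog hpos).continuousOn.comp
    (fun _ hx => (hasDerivAt_div_sub_one hx).continuousAt.continuousWithinAt)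
    fun _ hx => div_sub_one_lt_one hx

/-- The pullback of dt/(1-t) under t = x/(x-1) is -dx/(1-x). This sign is the source of (-1)^r. -/
theorem hasDerivAt_landenPolylog_one_cons {t : List ℕ} (ht : ∀ a ∈ t, 0 < a) {x : ℝ} (hx : x < 1) :
    HasDerivAt (landenPolylog (1 :: t)) (-landenPolylog t x / (1 - x)) x := by
  have := (hasDerivAt_multiPolylog_one_cons ht (div_sub_one_lt_one hx)).comp x
    (hasDerivAt_div_sub_one hx)
  refine this.congr_deriv ?_
  have h1 : x - 1 ≠ 0 := sub_ne_zero.2 hx.ne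
  have h2 : 1 - x ≠ 0 := sub_ne_zero.2 hx.ne'
  have h3 : 1 - x / (x - 1) = 1 / (1 - x) := by field_simp; ring
  rw [h3, landenPolylog]
  field_simp
  ring

theorem hasDerivAt_landenPolylog_succ_cons {a : ℕ} {t : List ℕ} (ha : 0 < a)
    (ht : ∀ b ∈ t, 0 < b) {x : ℝ} (hx : x < 1) (hx0 : x ≠ 0) :
    HasDerivAt (landenPolylog ((a + 1) :: t)) (landenPolylog (a :: t) x / x / (1 - x)) x := by
  have h1 : x - 1 ≠ 0 := sub_ne_zero.2 hx.ne
  have h2 : 1 - x ≠ 0 := sub_ne_zero.2 hx.ne'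
  have := (hasDerivAt_multiPolylog_succ_cons ha ht (div_sub_one_lt_one hx)
    (div_ne_zero hx0 h1)).comp x (hasDerivAt_div_sub_one hx)
  refine this.congr_deriv ?_
  rw [landenPolylog]
  field_simp
  ring

/-! ### Growth at `1` -/

/-- Comparison with the primitive `B` of C(1-x)^(-ε-1) that vanishes at 0: both B - f and B + f are
monotone. The factor x in the conclusion is what permits a later division by x. -/
theorem abs_le_mul_rpow_of_hasDerivAt {f g : ℝ → ℝ} {C ε : ℝ} (hC : 0 ≤ C) (hε : 0 < ε)
    (hε1 : ε ≤ 1) (hf : ContinuousOn f (Ico 0 1)) (h0 : f 0 = 0)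
    (hd : ∀ x ∈ Ioo (0 : ℝ) 1, HasDerivAt f (g x / (1 - x)) x)
    (hg : ∀ x ∈ Ioo (0 : ℝ) 1, |g x| ≤ C * (1 - x) ^ (-ε)) {x : ℝ} (hx : x ∈ Ico (0 : ℝ) 1) :
    |f x| ≤ C / ε * x * (1 - x) ^ (-ε) := by
  let B : ℝ → ℝ := fun x => C / ε * ((1 - x) ^ (-ε) - 1)
  have hB : ∀ x < 1, HasDerivAt B (C * (1 - x) ^ (-ε) / (1 - x)) x := by
    intro x hx
    have h1 : 0 < 1 - x := by linarith
    have := ((((hasDerivAt_id x).const_sub 1).rpow_const (p := -ε) (Or.inl h1.ne')).sub_const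
      1).const_mul (C / ε)
    refine this.congr_deriv ?_
    rw [id, Real.rpow_sub_one h1.ne']
    field_simp
  have hBc : ContinuousOn B (Ico 0 1) := fun x hx => (hB x hx.2).continuousAt.continuousWithinAt
  have h01 : (0 : ℝ) ∈ Ico (0 : ℝ) 1 := ⟨le_rfl, one_pos⟩
  have hB0 : B 0 = 0 := by simp [B]
  have hle : ∀ x ∈ Ioo (0 : ℝ) 1, |g x / (1 - x)| ≤ C * (1 - x) ^ (-ε) / (1 - x) := by
    intro x hx
    have h1 : 0 < 1 - x := by linarith [hx.2]
    rw [abs_div, abs_of_pos h1]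
    exact div_le_div_of_nonneg_right (hg x hx) h1.le
  have m1 : MonotoneOn (fun x => B x - f x) (Ico 0 1) := by
    refine monotoneOn_of_hasDerivWithinAt_nonneg (convex_Ico 0 1) (hBc.sub hf)
      (f' := fun x => C * (1 - x) ^ (-ε) / (1 - x) - g x / (1 - x)) ?_ ?_
    · rw [interior_Ico]
      exact fun x hx => ((hB x hx.2).sub (hd x hx)).hasDerivWithinAt
    · rw [interior_Ico]
      exact fun x hx => sub_nonneg.2 ((abs_le.1 (hle x hx)).2)
  have m2 : MonotoneOn (fun x => B x + f x) (Ico 0 1) := by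
    refine monotoneOn_of_hasDerivWithinAt_nonneg (convex_Ico 0 1) (hBc.add hf)
      (f' := fun x => C * (1 - x) ^ (-ε) / (1 - x) + g x / (1 - x)) ?_ ?_
    · rw [interior_Ico]
      exact fun x hx => ((hB x hx.2).add (hd x hx)).hasDerivWithinAt
    · rw [interior_Ico]
      exact fun x hx => by linarith [(abs_le.1 (hle x hx)).1]
  have e1 : B 0 - f 0 ≤ B x - f x := m1 h01 hx hx.1
  have e2 : B 0 + f 0 ≤ B x + f x := m2 h01 hx hx.1
  have h1 : 0 < 1 - x := by linarith [hx.2]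
  -- Equivalent to (1-x)^(-ε) - 1 ≤ x(1-x)^(-ε); this is where ε ≤ 1 enters.
  have e3 : (1 - x) * (1 - x) ^ (-ε) ≤ 1 := by
    have h : (1 - x) * (1 - x) ^ (-ε) = (1 - x) ^ (1 + -ε) := by
      rw [Real.rpow_add h1, Real.rpow_one]
    rw [h]
    exact Real.rpow_le_one h1.le (by linarith [hx.1]) (by linarith)
  have e4 : B x ≤ C / ε * x * (1 - x) ^ (-ε) := by
    have : 0 ≤ C / ε := by positivity
    rw [mul_assoc]
    exact mul_le_mul_of_nonneg_left (by linarith) this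
  rw [abs_le]
  constructor <;> linarith

/-- The exponent ε survives every integration and only the constant grows, by 1/ε each time. Two
bounds are carried along: the one with the factor x is needed when the next form is dx/(x(1-x)), but
it fails for the empty composition, which equals 1 at x = 0. -/
theorem exists_landenPolylog_bound {k : List ℕ} (hpos : ∀ a ∈ k, 0 < a) {ε : ℝ} (hε : 0 < ε)
    (hε1 : ε ≤ 1) :
    ∃ C, 0 ≤ C ∧ (∀ x ∈ Ico (0 : ℝ) 1, |landenPolylog k x| ≤ C * (1 - x) ^ (-ε)) ∧
      (k ≠ [] → ∀ x ∈ Ico (0 : ℝ) 1, |landenPolylog k x| ≤ C * x * (1 - x) ^ (-ε)) := by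
  have weaken : ∀ (f : ℝ → ℝ) (C : ℝ), 0 ≤ C →
      (∀ x ∈ Ico (0 : ℝ) 1, |f x| ≤ C * x * (1 - x) ^ (-ε)) →
      ∀ x ∈ Ico (0 : ℝ) 1, |f x| ≤ C * (1 - x) ^ (-ε) := by
    intro f C hC h x hx
    refine (h x hx).trans (mul_le_mul_of_nonneg_right ?_ (Real.rpow_nonneg (by linarith [hx.2]) _))
    exact mul_le_of_le_one_right hC hx.2.le
  have hsub : Ico (0 : ℝ) 1 ⊆ Iio 1 := fun x hx => hx.2
  refine composition_induction (P := fun k => ∃ C, 0 ≤ C ∧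
    (∀ x ∈ Ico (0 : ℝ) 1, |landenPolylog k x| ≤ C * (1 - x) ^ (-ε)) ∧
      (k ≠ [] → ∀ x ∈ Ico (0 : ℝ) 1, |landenPolylog k x| ≤ C * x * (1 - x) ^ (-ε)))
    ⟨1, zero_le_one, fun x hx => ?_, fun h => absurd rfl h⟩ (fun t ht ih => ?_)
    (fun a t ha ht ih => ?_) k hpos
  · have : 1 ≤ (1 - x) ^ (-ε) :=
      Real.one_le_rpow_of_pos_of_le_one_of_nonpos (by linarith [hx.2]) (by linarith [hx.1])
        (by linarith)
    simpa [landenPolylog, multiPolylog] using this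
  · obtain ⟨C, hC, h1, -⟩ := ih
    have hp : ∀ b ∈ 1 :: t, 0 < b := by simpa using ht
    have h := fun x hx => abs_le_mul_rpow_of_hasDerivAt hC hε hε1
      ((continuousOn_landenPolylog hp).mono hsub) (landenPolylog_zero (by simp) hp)
      (g := fun x => -landenPolylog t x)
      (fun x hx => hasDerivAt_landenPolylog_one_cons ht hx.2)
      (fun x hx => by simpa using h1 x ⟨hx.1.le, hx.2⟩) (x := x) hx
    exact ⟨C / ε, by positivity, weaken _ _ (by positivity) h, fun _ => h⟩
  · obtain ⟨C, hC, -, h2⟩ := ih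
    have hp : ∀ b ∈ (a + 1) :: t, 0 < b := by simpa using ht
    have h := fun x hx => abs_le_mul_rpow_of_hasDerivAt hC hε hε1
      ((continuousOn_landenPolylog hp).mono hsub) (landenPolylog_zero (by simp) hp)
      (g := fun x => landenPolylog (a :: t) x / x)
      (fun x hx => hasDerivAt_landenPolylog_succ_cons ha ht hx.2 hx.1.ne')
      (fun x hx => by
        rw [abs_div, abs_of_pos hx.1, div_le_iff₀ hx.1]
        linarith [h2 (by simp) x ⟨hx.1.le, hx.2⟩]) (x := x) hx
    exact ⟨C / ε, by positivity, weaken _ _ (by positivity) h, fun _ => h⟩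

/-! ### Integrals against powers of `1 - x` -/

theorem norm_one_sub_cpow {x : ℝ} (hx : x < 1) (s : ℂ) :
    ‖((1 - x : ℝ) : ℂ) ^ s‖ = (1 - x) ^ s.re :=
  Complex.norm_cpow_eq_rpow_re_of_pos (by linarith) s

theorem hasDerivAt_one_sub_cpow {x : ℝ} (hx : x < 1) (s : ℂ) :
    HasDerivAt (fun x : ℝ => ((1 - x : ℝ) : ℂ) ^ s) (-(s * ((1 - x : ℝ) : ℂ) ^ (s - 1))) x := by
  have h : HasDerivAt (fun z : ℂ => (1 - z) ^ s) (s * (1 - (x : ℂ)) ^ (s - 1) * (-1)) (x : ℂ) := by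
    refine ((hasDerivAt_id (x : ℂ)).const_sub 1).cpow_const ?_
    left
    simpa using hx
  have := h.comp_ofReal
  push_cast
  simpa using this

theorem continuousOn_one_sub_cpow (s : ℂ) :
    ContinuousOn (fun x : ℝ => ((1 - x : ℝ) : ℂ) ^ s) (Iio 1) := fun _ hx =>
  (hasDerivAt_one_sub_cpow hx s).continuousAt.continuousWithinAt

theorem integrableOn_one_sub_rpow {r : ℝ} (hr : -1 < r) :
    IntegrableOn (fun x : ℝ => (1 - x) ^ r) (Ioo 0 1) := by
  have h := (intervalIntegral.intervalIntegrable_rpow' (a := 1) (b := 0) hr).comp_sub_left 1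
  rw [sub_self, sub_zero] at h
  exact (intervalIntegrable_iff_integrableOn_Ioo_of_le zero_le_one).1 h

theorem integrableOn_mul_one_sub_cpow {F : ℝ → ℝ} {C ε : ℝ} {s : ℂ} (hs : ε < s.re)
    (hF : ContinuousOn F (Ioo 0 1)) (hb : ∀ x ∈ Ioo (0 : ℝ) 1, |F x| ≤ C * (1 - x) ^ (-ε)) :
    IntegrableOn (fun x => (F x : ℂ) * ((1 - x : ℝ) : ℂ) ^ (s - 1)) (Ioo 0 1) := by
  have hsub : Ioo (0 : ℝ) 1 ⊆ Iio 1 := fun x hx => hx.2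
  refine Integrable.mono' ((integrableOn_one_sub_rpow
    (r := -ε + (s.re - 1)) (by linarith)).const_mul C) ?_ ?_
  · exact ((Complex.continuous_ofReal.comp_continuousOn hF).mul
      ((continuousOn_one_sub_cpow _).mono hsub)).aestronglyMeasurable measurableSet_Ioo
  · refine (ae_restrict_iff' measurableSet_Ioo).2 (Eventually.of_forall fun x hx => ?_)
    have h1 : 0 < 1 - x := by linarith [hx.2]
    rw [norm_mul, norm_one_sub_cpow hx.2, Complex.norm_real, Real.norm_eq_abs,
      Real.rpow_add h1, ← mul_assoc, Complex.sub_re, Complex.one_re]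
    exact mul_le_mul_of_nonneg_right (hb x hx) (Real.rpow_nonneg h1.le _)

/-- Integration by parts against a power of `1 - x`. -/
theorem integral_mul_one_sub_cpow {F g : ℝ → ℝ} {C D ε : ℝ} {s : ℂ} (hs : ε < s.re) (hε : 0 < ε)
    (hF : ContinuousOn F (Iio 1)) (hg : ContinuousOn g (Ioo 0 1))
    (hd : ∀ x ∈ Ioo (0 : ℝ) 1, HasDerivAt F (g x / (1 - x)) x)
    (hFb : ∀ x ∈ Ioo (0 : ℝ) 1, |F x| ≤ C * (1 - x) ^ (-ε))
    (hgb : ∀ x ∈ Ioo (0 : ℝ) 1, |g x| ≤ D * (1 - x) ^ (-ε)) :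
    ∫ x in Ioo (0 : ℝ) 1, (F x : ℂ) * ((1 - x : ℝ) : ℂ) ^ (s - 1) =
      (F 0 + ∫ x in Ioo (0 : ℝ) 1, (g x : ℂ) * ((1 - x : ℝ) : ℂ) ^ (s - 1)) / s := by
  have hs0 : s ≠ 0 := by
    rintro rfl
    simp at hs
    linarith
  have hsub : Ioo (0 : ℝ) 1 ⊆ Iio 1 := fun x hx => hx.2
  have iF := integrableOn_mul_one_sub_cpow hs (hF.mono hsub) hFb
  have ig := integrableOn_mul_one_sub_cpow hs hg hgb
  have hder : ∀ x ∈ Ioo (0 : ℝ) 1, HasDerivAt (fun x => (F x : ℂ) * ((1 - x : ℝ) : ℂ) ^ s)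
      ((g x : ℂ) * ((1 - x : ℝ) : ℂ) ^ (s - 1) - s * ((F x : ℂ) * ((1 - x : ℝ) : ℂ) ^ (s - 1)))
      x := by
    intro x hx
    have h1 : ((1 - x : ℝ) : ℂ) ≠ 0 := Complex.ofReal_ne_zero.2 (by linarith [hx.2])
    refine ((hd x hx).ofReal_comp.mul (hasDerivAt_one_sub_cpow hx.2 s)).congr_deriv ?_
    rw [Complex.cpow_sub _ _ h1, Complex.cpow_one]
    push_cast at h1 ⊢
    field_simp
    ring
  have hw : ContinuousOn (fun x => (F x : ℂ) * ((1 - x : ℝ) : ℂ) ^ s) (Iio 1) :=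
    (Complex.continuous_ofReal.comp_continuousOn hF).mul (continuousOn_one_sub_cpow s)
  have l0 : Tendsto (fun x => (F x : ℂ) * ((1 - x : ℝ) : ℂ) ^ s) (𝓝[>] 0) (𝓝 (F 0 : ℂ)) := by
    have := (hw.continuousAt (Iio_mem_nhds one_pos)).tendsto.mono_left
      (nhdsWithin_le_nhds (s := Ioi (0 : ℝ)))
    simpa using this
  have l1 : Tendsto (fun x => (F x : ℂ) * ((1 - x : ℝ) : ℂ) ^ s) (𝓝[<] 1) (𝓝 0) := by
    have hz : Tendsto (fun x : ℝ => C * (1 - x) ^ (-ε + s.re)) (𝓝[<] 1) (𝓝 0) := by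
      have hc : ContinuousAt (fun x : ℝ => C * (1 - x) ^ (-ε + s.re)) 1 := by
        refine continuousAt_const.mul (ContinuousAt.rpow_const (by fun_prop) (Or.inr ?_))
        linarith
      have := hc.tendsto.mono_left (nhdsWithin_le_nhds (s := Iio (1 : ℝ)))
      simpa [Real.zero_rpow (by linarith : -ε + s.re ≠ 0)] using this
    refine squeeze_zero_norm' ?_ hz
    filter_upwards [Ioo_mem_nhdsLT (zero_lt_one' ℝ)] with x hx
    have h1 : 0 < 1 - x := by linarith [hx.2]
    rw [norm_mul, norm_one_sub_cpow hx.2, Complex.norm_real, Real.norm_eq_abs,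
      Real.rpow_add h1, ← mul_assoc]
    exact mul_le_mul_of_nonneg_right (hFb x hx) (Real.rpow_nonneg h1.le _)
  have key := intervalIntegral.integral_eq_sub_of_hasDerivAt_of_tendsto zero_lt_one hder
    ((intervalIntegrable_iff_integrableOn_Ioo_of_le zero_le_one).2 (ig.sub (iF.const_mul s))) l0 l1
  rw [intervalIntegral.integral_of_le zero_le_one, integral_Ioc_eq_integral_Ioo,
    integral_sub ig (iF.const_mul s), integral_const_mul] at key
  rw [eq_div_iff hs0]
  linear_combination -key

/-- Expands 1/x = ∑ (1-x)^N. The norms of the terms sum to the norm of the limit integrand, which is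
integrable by the growth bound, so dominated convergence applies. -/
theorem hasSum_integral_mul_one_sub_cpow {F : ℝ → ℝ} {C ε : ℝ} {s : ℂ} (hs : ε < s.re)
    (hF : ContinuousOn F (Iio 1)) (hFb : ∀ x ∈ Ioo (0 : ℝ) 1, |F x / x| ≤ C * (1 - x) ^ (-ε)) :
    HasSum (fun N : ℕ => ∫ x in Ioo (0 : ℝ) 1, (F x : ℂ) * ((1 - x : ℝ) : ℂ) ^ (s + N - 1))
      (∫ x in Ioo (0 : ℝ) 1, ((F x / x : ℝ) : ℂ) * ((1 - x : ℝ) : ℂ) ^ (s - 1)) := by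
  have hsub : Ioo (0 : ℝ) 1 ⊆ Iio 1 := fun x hx => hx.2
  have hquot : ContinuousOn (fun x => F x / x) (Ioo 0 1) :=
    (hF.mono hsub).div continuousOn_id fun x hx => hx.1.ne'
  have hi := integrableOn_mul_one_sub_cpow hs hquot hFb
  have hpow : ∀ x ∈ Ioo (0 : ℝ) 1, ∀ N : ℕ, ((1 - x : ℝ) : ℂ) ^ (s + N - 1) =
      ((1 - x : ℝ) : ℂ) ^ (s - 1) * ((1 - x : ℝ) : ℂ) ^ N := by
    intro x hx N
    have h1 : ((1 - x : ℝ) : ℂ) ≠ 0 := Complex.ofReal_ne_zero.2 (by linarith [hx.2])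
    rw [← Complex.cpow_natCast, ← Complex.cpow_add _ _ h1]
    congr 1
    ring
  have hgeom : ∀ x ∈ Ioo (0 : ℝ) 1, HasSum (fun N : ℕ => (1 - x) ^ N) x⁻¹ := by
    intro x hx
    simpa using hasSum_geometric_of_lt_one (r := 1 - x) (by linarith [hx.2]) (by linarith [hx.1])
  have hae : ∀ {P : ℝ → Prop}, (∀ x ∈ Ioo (0 : ℝ) 1, P x) →
      ∀ᵐ x ∂(volume.restrict (Ioo (0 : ℝ) 1)), P x := fun h =>
    (ae_restrict_iff' measurableSet_Ioo).2 (Eventually.of_forall h)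
  have hbound : ∀ x ∈ Ioo (0 : ℝ) 1,
      HasSum (fun N : ℕ => ‖(F x : ℂ) * ((1 - x : ℝ) : ℂ) ^ (s - 1)‖ * (1 - x) ^ N)
        ‖((F x / x : ℝ) : ℂ) * ((1 - x : ℝ) : ℂ) ^ (s - 1)‖ := by
    intro x hx
    have h : ‖((F x / x : ℝ) : ℂ) * ((1 - x : ℝ) : ℂ) ^ (s - 1)‖ =
        ‖(F x : ℂ) * ((1 - x : ℝ) : ℂ) ^ (s - 1)‖ * x⁻¹ := by
      rw [norm_mul, norm_mul, Complex.norm_real, Complex.norm_real, norm_div,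
        Real.norm_of_nonneg hx.1.le]
      ring
    rw [h]
    exact (hgeom x hx).mul_left _
  refine hasSum_integral_of_dominated_convergence
    (fun (N : ℕ) x => ‖(F x : ℂ) * ((1 - x : ℝ) : ℂ) ^ (s - 1)‖ * (1 - x) ^ N)
    (fun N => ?_) (fun N => hae fun x hx => ?_) (hae fun x hx => (hbound x hx).summable) ?_
    (hae fun x hx => ?_)
  · exact ((Complex.continuous_ofReal.comp_continuousOn (hF.mono hsub)).mul
      ((continuousOn_one_sub_cpow _).mono hsub)).aestronglyMeasurable measurableSet_Ioo
  · rw [hpow x hx, ← mul_assoc, norm_mul _ (((1 - x : ℝ) : ℂ) ^ N), norm_pow, Complex.norm_real,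
      Real.norm_of_nonneg (by linarith [hx.2])]
  · exact hi.norm.congr (hae fun x hx => (hbound x hx).tsum_eq.symm)
  · have h : ((F x / x : ℝ) : ℂ) * ((1 - x : ℝ) : ℂ) ^ (s - 1) =
        (F x : ℂ) * ((1 - x : ℝ) : ℂ) ^ (s - 1) * ((x⁻¹ : ℝ) : ℂ) := by
      push_cast
      ring
    rw [h]
    refine ((Complex.hasSum_ofReal.2 (hgeom x hx)).mul_left _).congr_fun fun N => ?_
    rw [hpow x hx, Complex.ofReal_pow, mul_assoc]

/-! ### The integral as a nested sum -/

/-- `M ↦ 1 / (M - α)^e`. -/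
noncomputable def starWeight (α : ℂ) (e M : ℕ) : ℂ := 1 / ((M : ℂ) - α) ^ e

/-- The part of a nested star sum with smallest summation variable `n`; the exponents are listed
from the smallest summation variable to the largest one. -/
noncomputable def starTail (α : ℂ) : List ℕ → ℕ → ℂ
  -- An immaterial value, since `exponents` is never empty; with 0, `starTail_plusHead` needs no
  -- nonemptiness assumption.
  | [], _ => 0
  | m :: l, n => starWeight α m n * nestedSum (fun a b => a ≤ b) (l.map (starWeight α)) (Ici n)

theorem nestedSum_starWeight (α : ℂ) {l : List ℕ} (hl : l ≠ []) (n : ℕ) :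
    nestedSum (fun a b => a ≤ b) (l.map (starWeight α)) (Ici n) =
      ∑' N : ℕ, starTail α l (n + N) := by
  obtain ⟨m, t, rfl⟩ := List.exists_cons_of_ne_nil hl
  let e : ℕ ≃ Ici n :=
    { toFun := fun N => ⟨n + N, Nat.le_add_right n N⟩
      invFun := fun M => M - n
      left_inv := fun N => Nat.add_sub_cancel_left n N
      right_inv := fun M => Subtype.ext (Nat.add_sub_cancel' M.2) }
  rw [List.map_cons, nestedSum, ← e.tsum_eq]
  refine tsum_congr fun N => ?_
  have h : Ici n ∩ {M' | (e N : ℕ) ≤ M'} = Ici (n + N) := by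
    ext x
    simp only [e, Equiv.coe_fn_mk, mem_inter_iff, mem_Ici, mem_ofPred_eq]
    omega
  rw [h, starTail]
  rfl

theorem starTail_one_cons (α : ℂ) {l : List ℕ} (hl : l ≠ []) (n : ℕ) :
    starTail α (1 :: l) n = (∑' N : ℕ, starTail α l (n + N)) / ((n : ℂ) - α) := by
  rw [starTail, nestedSum_starWeight α hl, starWeight, pow_one]
  ring

theorem starTail_plusHead (α : ℂ) (l : List ℕ) (n : ℕ) :
    starTail α (plusHead l) n = starTail α l n / ((n : ℂ) - α) := by
  cases l with
  | nil => simp [plusHead, starTail]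
  | cons m l =>
    simp only [plusHead, starTail, starWeight, pow_succ, one_div, mul_inv]
    ring

/-- A growth exponent small enough for all integrals attached to `α`. -/
theorem exists_growth_exponent {σ : ℝ} (hσ : σ < 1) : ∃ ε : ℝ, 0 < ε ∧ ε ≤ 1 ∧ ε < 1 - σ := by
  refine ⟨min 1 ((1 - σ) / 2), lt_min one_pos (by linarith), min_le_left _ _, ?_⟩
  exact (min_le_right _ _).trans_lt (by linarith)

theorem landenPolylog_div_bound {f : ℝ → ℝ} {C ε : ℝ}
    (h : ∀ x ∈ Ico (0 : ℝ) 1, |f x| ≤ C * x * (1 - x) ^ (-ε)) :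
    ∀ x ∈ Ioo (0 : ℝ) 1, |f x / x| ≤ C * (1 - x) ^ (-ε) := by
  intro x hx
  rw [abs_div, abs_of_pos hx.1, div_le_iff₀ hx.1]
  linarith [h x ⟨hx.1.le, hx.2⟩]

/-- All `n` must be treated at once, because expanding 1/x calls on the induction hypothesis at
every n + N. -/
theorem integral_landenPolylog {α : ℂ} (hα : α.re < 1) {k : List ℕ} (hpos : ∀ a ∈ k, 0 < a) :
    ∀ n : ℕ, 0 < n →
      ∫ x in Ioo (0 : ℝ) 1, (landenPolylog k x : ℂ) * ((1 - x : ℝ) : ℂ) ^ ((n : ℂ) - α - 1) =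
        (-1) ^ k.length * starTail α (exponents k) n := by
  obtain ⟨ε, hε, hε1, hεα⟩ := exists_growth_exponent hα
  have hre : ∀ n : ℕ, 0 < n → ε < ((n : ℂ) - α).re := by
    intro n hn
    have : (1 : ℝ) ≤ n := by exact_mod_cast hn
    simp only [Complex.sub_re, Complex.natCast_re]
    linarith
  have hsub : Ioo (0 : ℝ) 1 ⊆ Iio 1 := fun x hx => hx.2
  have hIco : ∀ {x : ℝ}, x ∈ Ioo (0 : ℝ) 1 → x ∈ Ico (0 : ℝ) 1 := fun hx => ⟨hx.1.le, hx.2⟩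
  refine composition_induction (P := fun k => ∀ n : ℕ, 0 < n →
      ∫ x in Ioo (0 : ℝ) 1, (landenPolylog k x : ℂ) * ((1 - x : ℝ) : ℂ) ^ ((n : ℂ) - α - 1) =
        (-1) ^ k.length * starTail α (exponents k) n)
    (fun n hn => ?_) (fun t ht ih n hn => ?_) (fun a t ha ht ih n hn => ?_) k hpos
  -- Here F = 1 and g = 0, so the value comes entirely from the boundary term at 0. In the two other
  -- cases that term vanishes.
  · have hnil : ∀ a ∈ ([] : List ℕ), 0 < a := by simp
    obtain ⟨C, -, hb, -⟩ := exists_landenPolylog_bound hnil hε hε1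
    rw [integral_mul_one_sub_cpow (g := fun _ => 0) (D := 0) (hre n hn) hε
      (continuousOn_landenPolylog hnil) continuousOn_const
      (fun x _ => (hasDerivAt_const x (1 : ℝ)).congr_deriv (by simp))
      (fun x hx => hb x (hIco hx)) (by simp)]
    simp [landenPolylog, multiPolylog, exponents, starTail, starWeight, nestedSum]
  · have hp : ∀ b ∈ 1 :: t, 0 < b := by simpa using ht
    obtain ⟨C, -, hb, -⟩ := exists_landenPolylog_bound hp hε hε1
    obtain ⟨D, -, hbt, -⟩ := exists_landenPolylog_bound ht hε hε1
    rw [integral_mul_one_sub_cpow (g := fun x => -landenPolylog t x) (hre n hn) hε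
      (continuousOn_landenPolylog hp) ((continuousOn_landenPolylog ht).mono hsub).neg
      (fun x hx => hasDerivAt_landenPolylog_one_cons ht hx.2)
      (fun x hx => hb x (hIco hx)) (fun x hx => by simpa using hbt x (hIco hx))]
    simp only [Complex.ofReal_neg, neg_mul, integral_neg]
    rw [ih n hn, landenPolylog_zero (by simp) hp, exponents_one_cons, starTail_plusHead,
      List.length_cons, pow_succ, Complex.ofReal_zero]
    ring
  · have hp : ∀ b ∈ (a + 1) :: t, 0 < b := by simpa using ht
    have hp' : ∀ b ∈ a :: t, 0 < b := by simpa using ⟨ha, ht⟩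
    obtain ⟨C, -, hb, -⟩ := exists_landenPolylog_bound hp hε hε1
    obtain ⟨D, -, -, hbt⟩ := exists_landenPolylog_bound hp' hε hε1
    have hdiv := landenPolylog_div_bound (hbt (by simp))
    rw [integral_mul_one_sub_cpow (g := fun x => landenPolylog (a :: t) x / x) (hre n hn) hε
      (continuousOn_landenPolylog hp)
      (((continuousOn_landenPolylog hp').mono hsub).div continuousOn_id fun x hx => hx.1.ne')
      (fun x hx => hasDerivAt_landenPolylog_succ_cons ha ht hx.2 hx.1.ne')
      (fun x hx => hb x (hIco hx)) hdiv]
    have hN : ∀ N : ℕ, ∫ x in Ioo (0 : ℝ) 1, (landenPolylog (a :: t) x : ℂ) *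
        ((1 - x : ℝ) : ℂ) ^ ((n : ℂ) - α + N - 1) =
          (-1) ^ (a :: t).length * starTail α (exponents (a :: t)) (n + N) := by
      intro N
      rw [← ih (n + N) (by omega), Nat.cast_add, sub_add_eq_add_sub]
    rw [← (hasSum_integral_mul_one_sub_cpow (hre n hn) (continuousOn_landenPolylog hp')
      hdiv).tsum_eq, tsum_congr hN, tsum_mul_left, landenPolylog_zero (by simp) hp,
      exponents_succ_cons ha, starTail_one_cons α (exponents_ne_nil _), List.length_cons,
      List.length_cons, Complex.ofReal_zero]
    ring

theorem integrand_eq (k : List ℕ) (α : ℂ) (x : ℝ) :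
    ((landenPolylog k x / x : ℝ) : ℂ) * ((1 - x : ℝ) : ℂ) ^ ((1 - α) - 1) = integrand k α x := by
  have h : (1 - α) - 1 = -α := by ring
  rw [integrand, h, Complex.cpow_neg, landenPolylog, Complex.ofReal_div]
  rw [div_mul_eq_div_div, div_eq_mul_inv _ (((1 - x : ℝ) : ℂ) ^ α)]

theorem integral_integrand {α : ℂ} (hα : α.re < 1) {k : List ℕ} (hk : k ≠ [])
    (hpos : ∀ a ∈ k, 0 < a) :
    IntegrableOn (integrand k α) (Ioo (0 : ℝ) 1) ∧
      ∫ x in Ioo (0 : ℝ) 1, integrand k α x = (-1) ^ k.length *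
        nestedSum (fun a b => a ≤ b) ((exponents k).map (starWeight α)) (Ici 1) := by
  obtain ⟨ε, hε, hε1, hεα⟩ := exists_growth_exponent hα
  obtain ⟨D, -, -, hb⟩ := exists_landenPolylog_bound hpos hε hε1
  have hdiv := landenPolylog_div_bound (hb hk)
  have hre : ε < (1 - α).re := by simpa using hεα
  have hsub : Ioo (0 : ℝ) 1 ⊆ Iio 1 := fun x hx => hx.2
  have hi := integrableOn_mul_one_sub_cpow hre
    (((continuousOn_landenPolylog hpos).mono hsub).div continuousOn_id fun x hx => hx.1.ne') hdiv
  refine ⟨hi.congr_fun (fun x _ => integrand_eq k α x) measurableSet_Ioo, ?_⟩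
  rw [← setIntegral_congr_fun measurableSet_Ioo (fun x _ => integrand_eq k α x),
    ← (hasSum_integral_mul_one_sub_cpow hre (continuousOn_landenPolylog hpos) hdiv).tsum_eq,
    nestedSum_starWeight α (exponents_ne_nil k), ← tsum_mul_left]
  refine tsum_congr fun N => ?_
  rw [← integral_landenPolylog hα hpos (1 + N) (by omega), Nat.cast_add, Nat.cast_one,
    sub_add_eq_add_sub]

/-! ### The star value on `ℂ ∖ {1, 2, 3, …}` -/

theorem punctured_eq_compl : punctured = ((fun n : ℕ => (n : ℂ)) '' Ioi 0)ᶜ := by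
  ext α
  simp only [punctured, mem_ofPred_eq, mem_compl_iff, mem_image, mem_Ioi, not_exists, not_and]
  exact forall₂_congr fun n _ => ne_comm

theorem isOpen_punctured : IsOpen punctured := by
  have h := Complex.isometry_ofReal.isClosedEmbedding.comp Nat.isClosedEmbedding_coe_real
  rw [punctured_eq_compl]
  exact (h.isClosedMap _ (isClosed_discrete (Ioi 0))).isOpen_compl

/-- The complement of a countable set in a real vector space of dimension greater than one is
connected. -/
theorem isPreconnected_punctured : IsPreconnected punctured := by
  rw [punctured_eq_compl]
  exact (((to_countable (Ioi (0 : ℕ))).image _).isConnected_compl_of_one_lt_rank (by simp)).isPreconnected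

/-- Uniformly for β near α, the distance |n-β| is at least a multiple of n, which reduces
convergence of the star series to the case of the weights 1/n^m. -/
theorem exists_mul_le_norm_sub {α : ℂ} (hα : α ∈ punctured) :
    ∃ c : ℝ, 0 < c ∧ ∀ β ∈ Metric.ball α c, ∀ n : ℕ, 0 < n → c * n ≤ ‖(n : ℂ) - β‖ := by
  obtain ⟨δ, hδ, hball⟩ := Metric.isOpen_iff.1 isOpen_punctured α hα
  have hlow : ∀ n : ℕ, 0 < n → δ ≤ ‖(n : ℂ) - α‖ := by
    intro n hn
    by_contra! h
    exact hball (show (n : ℂ) ∈ Metric.ball α δ by rwa [mem_ball_iff_norm]) n hn rfl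
  let M : ℝ := 1 + ‖α‖ / δ
  have hM : 0 < M := by positivity
  -- The bound n/M ≤ |n-α| loses at most 1/(2M) ≤ n/(2M) on passing from α to β, so half of it
  -- remains.
  refine ⟨1 / (2 * M), by positivity, fun β hβ n hn => ?_⟩
  have h1 : (n : ℝ) ≤ M * ‖(n : ℂ) - α‖ := by
    have h2 : (n : ℝ) ≤ ‖(n : ℂ) - α‖ + ‖α‖ := by
      simpa using norm_add_le ((n : ℂ) - α) α
    have h3 : ‖α‖ ≤ ‖α‖ / δ * ‖(n : ℂ) - α‖ := by
      rw [div_mul_eq_mul_div, le_div_iff₀ hδ]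
      exact mul_le_mul_of_nonneg_left (hlow n hn) (norm_nonneg _)
    simp only [M]
    linarith
  have h4 : ‖(n : ℂ) - α‖ ≤ ‖(n : ℂ) - β‖ + 1 / (2 * M) := by
    have := norm_add_le ((n : ℂ) - β) (β - α)
    rw [sub_add_sub_cancel] at this
    linarith [mem_ball_iff_norm.1 hβ]
  have h5 : (n : ℝ) / M ≤ ‖(n : ℂ) - α‖ := by
    rw [div_le_iff₀ hM]
    linarith
  have h6 : 1 / (2 * M) ≤ 1 / (2 * M) * n :=
    le_mul_of_one_le_right (by positivity) (by exact_mod_cast hn)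
  have h7 : (n : ℝ) / M = 1 / (2 * M) * n + 1 / (2 * M) * n := by
    field_simp
    ring
  linarith

/-- The exponent at least 2 on the largest entry provides a spare factor n₀. Splitting it into r+1
equal roots and using n₀ ≥ n_i gives every variable the exponent 1 + 1/(r+1) > 1. -/
theorem prod_one_div_pow_le {r : ℕ} {m : Fin (r + 1) → ℕ} (hm : ∀ i, 1 ≤ m i) (hm0 : 2 ≤ m 0)
    {n : Fin (r + 1) → ℕ} (hn : Antitone n) (hpos : ∀ i, 0 < n i) :
    ∏ i, 1 / (n i : ℝ) ^ m i ≤ ∏ i, 1 / (n i : ℝ) ^ (1 + 1 / ((r : ℝ) + 1)) := by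
  have h1 : ∀ i, (1 : ℝ) ≤ n i := fun i => by exact_mod_cast hpos i
  have h0 : ∀ i, (0 : ℝ) < n i := fun i => by exact_mod_cast hpos i
  have hroot : ∏ _i : Fin (r + 1), (n 0 : ℝ) ^ (1 / ((r : ℝ) + 1)) = n 0 := by
    rw [Finset.prod_const, Finset.card_univ, Fintype.card_fin, ← Real.rpow_mul_natCast (h0 0).le]
    push_cast
    rw [one_div_mul_cancel (by positivity), Real.rpow_one]
  have key : ∏ i, (n i : ℝ) ^ (1 + 1 / ((r : ℝ) + 1)) ≤ ∏ i, (n i : ℝ) ^ m i :=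
    calc ∏ i, (n i : ℝ) ^ (1 + 1 / ((r : ℝ) + 1))
        = ∏ i, ((n i : ℝ) * (n i : ℝ) ^ (1 / ((r : ℝ) + 1))) :=
          Finset.prod_congr rfl fun i _ => by rw [Real.rpow_add (h0 i), Real.rpow_one]
      _ ≤ ∏ i, ((n i : ℝ) * (n 0 : ℝ) ^ (1 / ((r : ℝ) + 1))) := by
          refine Finset.prod_le_prod (fun i _ => by positivity) fun i _ => ?_
          have : n i ≤ n 0 := hn (Fin.zero_le i)
          gcongr
      _ = n 0 * ∏ i, (n i : ℝ) := by rw [Finset.prod_mul_distrib, hroot, mul_comm]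
      _ = (n 0 : ℝ) ^ 2 * ∏ i : Fin r, (n i.succ : ℝ) := by rw [Fin.prod_univ_succ]; ring
      _ ≤ (n 0 : ℝ) ^ m 0 * ∏ i : Fin r, (n i.succ : ℝ) ^ m i.succ := by
          refine mul_le_mul (pow_le_pow_right₀ (h1 0) hm0) ?_ (by positivity) (by positivity)
          exact Finset.prod_le_prod (fun i _ => by positivity) fun i _ =>
            le_self_pow₀ (h1 _) (by have := hm i.succ; omega)
      _ = ∏ i, (n i : ℝ) ^ m i := (Fin.prod_univ_succ fun i => (n i : ℝ) ^ m i).symm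
  simp only [Finset.prod_div_distrib, Finset.prod_const_one]
  exact one_div_le_one_div_of_le (Finset.prod_pos fun i _ => Real.rpow_pos_of_pos (h0 i) _) key

theorem summable_prod_one_div_pow {r : ℕ} {m : Fin (r + 1) → ℕ} (hm : ∀ i, 1 ≤ m i)
    (hm0 : 2 ≤ m 0) :
    Summable fun n : WeakTuples (r + 1) => ∏ i, 1 / (n.1 i : ℝ) ^ m i := by
  have hr : 1 < 1 + 1 / ((r : ℝ) + 1) := by
    have : 0 < 1 / ((r : ℝ) + 1) := by positivity
    linarith
  have hs := (summable_prod_tuples (f := fun n : ℕ => 1 / (n : ℝ) ^ (1 + 1 / ((r : ℝ) + 1)))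
    (fun n => by positivity) (Real.summable_one_div_nat_rpow.2 hr) (r + 1)).comp_injective
      (Subtype.val_injective (p := fun n : Fin (r + 1) → ℕ => Antitone n ∧ ∀ i, 0 < n i))
  exact hs.of_nonneg_of_le (fun n => Finset.prod_nonneg fun i _ => by positivity)
    fun n => prod_one_div_pow_le hm hm0 n.2.1 n.2.2

theorem zetaStarTerm_one_sub (m : List ℕ) (α : ℂ) (n : WeakTuples m.length) :
    zetaStarTerm m (1 - α) n = ∏ i, starWeight α (m.get i) (n.1 i) := by
  simp only [zetaStarTerm, starWeight, Finset.prod_div_distrib, Finset.prod_const_one]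
  congr 1
  refine Finset.prod_congr rfl fun i _ => ?_
  ring

/-- The terms of the star value are bounded by a summable family, locally uniformly. -/
theorem exists_zetaStarTerm_bound {b : ℕ} {s : List ℕ} (hb : 0 < b) (hs : ∀ a ∈ s, 0 < a) {α : ℂ}
    (hα : α ∈ punctured) :
    ∃ c : ℝ, 0 < c ∧ ∃ u : WeakTuples ((b + 1) :: s).length → ℝ, Summable u ∧
      ∀ n, ∀ β ∈ Metric.ball α c, ‖zetaStarTerm ((b + 1) :: s) (1 - β) n‖ ≤ u n := by
  obtain ⟨c, hc, hle⟩ := exists_mul_le_norm_sub hα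
  let m := ((b + 1) :: s).get
  have hm : ∀ i, 1 ≤ m i := fun i => by
    have := List.get_mem ((b + 1) :: s) i
    rcases List.mem_cons.1 this with h | h
    · simp only [m, h]; omega
    · exact hs _ h
  have hsum := (summable_prod_one_div_pow (r := s.length) (m := m) hm
    (show 2 ≤ b + 1 by omega)).mul_left (∏ i, 1 / c ^ m i)
  refine ⟨c, hc, _, hsum, fun n β hβ => ?_⟩
  rw [zetaStarTerm_one_sub, norm_prod]
  refine le_of_le_of_eq (b := ∏ i, (1 / c ^ m i * (1 / (n.1 i : ℝ) ^ m i))) ?_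
    Finset.prod_mul_distrib
  refine Finset.prod_le_prod (fun i _ => norm_nonneg _) fun i _ => ?_
  have hn : (0 : ℝ) < n.1 i := by exact_mod_cast n.2.2 i
  rw [starWeight, norm_div, norm_one, norm_pow, one_div_mul_one_div, ← mul_pow]
  exact one_div_le_one_div_of_le (by positivity)
    (pow_le_pow_left₀ (by positivity) (hle β hβ _ (n.2.2 i)) _)

theorem summable_zetaStarTerm {b : ℕ} {s : List ℕ} (hb : 0 < b) (hs : ∀ a ∈ s, 0 < a) {α : ℂ}
    (hα : α ∈ punctured) : Summable (zetaStarTerm ((b + 1) :: s) (1 - α)) := by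
  obtain ⟨c, hc, u, hu, h⟩ := exists_zetaStarTerm_bound hb hs hα
  exact hu.of_norm_bounded fun n => h n α (Metric.mem_ball_self hc)

theorem differentiableOn_zetaStar {b : ℕ} {s : List ℕ} (hb : 0 < b) (hs : ∀ a ∈ s, 0 < a) :
    DifferentiableOn ℂ (fun α => zetaStar ((b + 1) :: s) (1 - α)) punctured := by
  intro α hα
  obtain ⟨c, hc, u, hu, h⟩ := exists_zetaStarTerm_bound hb hs hα
  have hopen : IsOpen (Metric.ball α c ∩ punctured) := Metric.isOpen_ball.inter isOpen_punctured
  have hd : DifferentiableOn ℂ (fun α => zetaStar ((b + 1) :: s) (1 - α))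
      (Metric.ball α c ∩ punctured) := by
    refine Complex.differentiableOn_tsum_of_summable_norm hu (fun n => ?_) hopen
      fun n β hβ => h n β hβ.1
    refine DifferentiableOn.congr (f := fun β => ∏ i, starWeight β (((b + 1) :: s).get i) (n.1 i))
      ?_ fun β _ => zetaStarTerm_one_sub _ _ _
    refine DifferentiableOn.fun_finsetProd fun i _ => ?_
    refine DifferentiableOn.div (by fun_prop) (by fun_prop) fun β hβ => ?_
    exact pow_ne_zero _ (sub_ne_zero.2 (hβ.2 _ (n.2.2 i)).symm)
  exact (hd.differentiableAt (hopen.mem_nhds ⟨Metric.mem_ball_self hc, hα⟩)).differentiableWithinAt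

/-- Reversing the order of the summation variables. -/
def weakTuplesEquiv (r : ℕ) : NestedTuples (fun a b => a ≤ b) (Ici 1) r ≃ WeakTuples r where
  toFun n := ⟨fun i => n.1 i.rev, fun i j hij => by
    rcases hij.eq_or_lt with rfl | h
    · exact le_rfl
    · exact n.2.1 _ _ (Fin.rev_lt_rev.2 h), fun i => n.2.2 _⟩
  invFun n := ⟨fun i => n.1 i.rev, fun i j hij => n.2.1 (Fin.rev_le_rev.2 hij.le),
    fun i => n.2.2 _⟩
  left_inv n := by simp
  right_inv n := by simp

/-- The reversal occurs because the integral produces the sum with the smallest variable outermost,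
whereas ζ⋆ lists the largest variable first. -/
theorem zetaStar_eq_nestedSum {m : List ℕ} {α : ℂ} (h : Summable (zetaStarTerm m (1 - α))) :
    zetaStar m (1 - α) =
      nestedSum (fun a b => a ≤ b) (m.reverse.map (starWeight α)) (Ici 1) := by
  have hterm : ∀ n, zetaStarTerm m (1 - α) (weakTuplesEquiv m.length n) =
      ∏ i : Fin m.length, starWeight α (m.get i.rev) (n.1 i) := by
    intro n
    rw [zetaStarTerm_one_sub]
    exact Fintype.prod_equiv Fin.revPerm _ _ fun i => by simp [weakTuplesEquiv]
  have hofFn : List.ofFn (fun i : Fin m.length => starWeight α (m.get i.rev)) =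
      m.reverse.map (starWeight α) := by
    refine List.ext_getElem (by simp) fun i h1 h2 => ?_
    simp only [List.getElem_ofFn, List.getElem_map, List.getElem_reverse, List.get_eq_getElem,
      Fin.val_rev]
    congr 2
    omega
  have := hasSum_nestedSum (fun a b => a ≤ b)
    (fun i : Fin m.length => starWeight α (m.get i.rev)) (Ici 1)
    (((weakTuplesEquiv m.length).summable_iff.2 h).congr hterm)
  rw [hofFn] at this
  rw [zetaStar, ← (weakTuplesEquiv m.length).tsum_eq, tsum_congr hterm]
  exact this.tsum_eq

theorem exists_plusHead_hoffmanDual_eq {k : List ℕ} (hk : k ≠ []) (hpos : ∀ a ∈ k, 0 < a) :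
    ∃ b s, 0 < b ∧ (∀ a ∈ s, 0 < a) ∧ plusHead (hoffmanDual k.reverse) = (b + 1) :: s := by
  have hr : k.reverse ≠ [] := by simpa using hk
  have hp : ∀ a ∈ k.reverse, 0 < a := fun a ha => hpos a (List.mem_reverse.1 ha)
  have hd := (hoffmanDual_spec _ hr hp).1
  obtain ⟨b, s, h⟩ := List.exists_cons_of_ne_nil (hoffmanDual_ne_nil _ hr hp)
  rw [h] at hd ⊢
  exact ⟨b, s, hd b (by simp), fun a ha => hd a (List.mem_cons_of_mem _ ha), rfl⟩

theorem mem_punctured_of_re_lt_one {α : ℂ} (h : α.re < 1) : α ∈ punctured := by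
  rintro n hn rfl
  rw [Complex.natCast_re] at h
  exact absurd h (not_lt.2 (by exact_mod_cast hn))

end HurwitzStar

theorem mainTheorem3 (k : List ℕ) (hk : 0 < k.length) (hpos : ∀ a ∈ k, 0 < a) :
    -- `Li_k` is the real-analytic continuation to `(-∞, 1)` of the defining series
    (AnalyticOnNhd ℝ (HurwitzStar.multiPolylog k) (Set.Iio 1) ∧
      ∀ z : ℝ, |z| < 1 →
        HasSum (HurwitzStar.polylogTerm k hk z) (HurwitzStar.multiPolylog k z)) ∧
    -- the series of the star value converges absolutely on `ℂ ∖ {1, 2, 3, …}`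
    (∀ α ∈ HurwitzStar.punctured,
      Summable (HurwitzStar.zetaStarTerm
        (HurwitzStar.plusHead (HurwitzStar.hoffmanDual k.reverse)) (1 - α))) ∧
    -- the formula with the convergent integral
    (∀ α : ℂ, α.re < 1 →
      MeasureTheory.IntegrableOn (HurwitzStar.integrand k α) (Set.Ioo (0 : ℝ) 1) ∧
      ∫ x in Set.Ioo (0 : ℝ) 1, HurwitzStar.integrand k α x =
        (-1) ^ k.length * HurwitzStar.zetaStar
          (HurwitzStar.plusHead (HurwitzStar.hoffmanDual k.reverse)) (1 - α)) ∧
    -- the formula on all of `ℂ ∖ {1, 2, 3, …}`, with the integral continued holomorphically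
    (∃ I : ℂ → ℂ, HurwitzStar.IsContinuedIntegral k I) ∧
    (∀ I : ℂ → ℂ, HurwitzStar.IsContinuedIntegral k I → ∀ α ∈ HurwitzStar.punctured,
      I α = (-1) ^ k.length * HurwitzStar.zetaStar
        (HurwitzStar.plusHead (HurwitzStar.hoffmanDual k.reverse)) (1 - α)) := by
  have hne : k ≠ [] := List.ne_nil_of_length_pos hk
  obtain ⟨b, s, hb, hs, hm⟩ := HurwitzStar.exists_plusHead_hoffmanDual_eq hne hpos
  have hrev : (HurwitzStar.exponents k) = ((b + 1) :: s).reverse := by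
    rw [← hm, HurwitzStar.plusHead_hoffmanDual_reverse k hne hpos, List.reverse_reverse]
  have hformula : ∀ α : ℂ, α.re < 1 →
      IntegrableOn (HurwitzStar.integrand k α) (Ioo (0 : ℝ) 1) ∧
        ∫ x in Ioo (0 : ℝ) 1, HurwitzStar.integrand k α x =
          (-1) ^ k.length * HurwitzStar.zetaStar ((b + 1) :: s) (1 - α) := by
    intro α hα
    rw [HurwitzStar.zetaStar_eq_nestedSum (HurwitzStar.summable_zetaStarTerm hb hs
      (HurwitzStar.mem_punctured_of_re_lt_one hα)), ← hrev]
    exact HurwitzStar.integral_integrand hα hne hpos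
  have hdiff : DifferentiableOn ℂ
      (fun α => (-1) ^ k.length * HurwitzStar.zetaStar ((b + 1) :: s) (1 - α))
      HurwitzStar.punctured :=
    (HurwitzStar.differentiableOn_zetaStar hb hs).const_mul _
  rw [hm]
  refine ⟨⟨HurwitzStar.analyticOnNhd_multiPolylog hpos,
    fun z hz => HurwitzStar.hasSum_polylogTerm hk hpos hz⟩,
    fun α hα => HurwitzStar.summable_zetaStarTerm hb hs hα, hformula,
    ⟨_, hdiff, fun α hα => (hformula α hα).2.symm⟩, fun I hI α hα => ?_⟩
  have hopen : IsOpen {α : ℂ | α.re < 1} := isOpen_lt Complex.continuous_re continuous_const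
  -- Identity theorem: both sides are holomorphic on the connected open set and agree on the
  -- half-plane Re α < 1, a neighbourhood of 0.
  refine (hI.1.analyticOnNhd HurwitzStar.isOpen_punctured).eqOn_of_preconnected_of_eventuallyEq
    (hdiff.analyticOnNhd HurwitzStar.isOpen_punctured) HurwitzStar.isPreconnected_punctured
    (HurwitzStar.mem_punctured_of_re_lt_one (α := 0) (by simp)) ?_ hα
  filter_upwards [hopen.mem_nhds (show (0 : ℂ).re < 1 by simp)] with β hβ
  rw [hI.2 β hβ, (hformula β hβ).2]
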